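/- **Setting.** Let $q=e^{\hbar}$, in one of two senses. (A) *Numerical:* $\hbar\in\mathbb C$, the ground field is $\Bbbk=\mathbb C$, $q=e^\hbar$ is not a root of unity, and $q^z:=e^{\hbar z}$ for $z\in\mathbb C$. (B) *Formal:* $\Bbbk$ is any field extension of $\mathbb C((\hbar))$, and $q^z:=\sum_{n\ge0}(z\hbar)^n/n!$ for $z\in\mathbb C$. Put $[z]_q=\frac{q^z-q^{-z}}{q-q^{-1}}$ and $[m]_q!=[1]_q\cdots[m]_q$. Fix $0\ne c\in\Bbbk$ and $t\in\Bbbk$ with $t^2=c\,(q^2+1)/q$. *Quantum group and modules.* $U_q(\mathfrak{sl}_2)$ is generated by $E,F,K^{\pm1}$ with $KE=q^2EK$, $KF=q^{-2}FK$, $KK^{-1}=K^{-1}K=1$, $EF-FE=(K-K^{-1})/(q-q^{-1})$. For $\lambda\in\mathbb C$ the Verma module $M_{\lambda\pi}$ has basis $w_{\lambda-2m}$ ($m\ge 0$) with $$Kw_{\lambda-2m}=q^{\lambda-2m}w_{\lambda-2m},\quad Ew_{\lambda-2m}=[\lambda-m+1]_q\,w_{\lambda-2(m-1)},\quad Fw_{\lambda-2m}=[m+1]_q\,w_{\lambda-2(m+1)},$$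 where $w_{\lambda+2}=0$. For $k\in\mathbb Z_{\ge0}$ the module $V_{k\pi}$ has basis $w_{k},w_{k-2},\dots,w_{-k}$ and is given by the same formulas with $\lambda=k$ and $w_{-k-2}=0$. *Clifford algebra.* $V_{2\pi}$ has basis $v_2,v_0,v_{-2}$ with $Kv_i=q^iv_i$, $Ev_2=0$, $Ev_0=-(q+q^{-1})v_2$, $Ev_{-2}=v_0$, $Fv_2=-v_0$, $Fv_0=(q+q^{-1})v_{-2}$, $Fv_{-2}=0$. Let $\tilde\sigma$ be the normalized braiding of $V_{2\pi}\otimes V_{2\pi}\cong V_{4\pi}\oplus V_{2\pi}\oplus V_0$, the linear map that equals $1$ on $V_{4\pi}\oplus V_0$ and $-1$ on $V_{2\pi}$. Let $\langle\cdot,\cdot\rangle$ be the invariant bilinear form with $\langle v_2,v_{-2}\rangle=c$, $\langle v_0,v_0\rangle=(1+q^2)c/q^3$, $\langle v_{-2},v_2\rangle=c/q^2$ and all other values $0$ on basis vectors. $\mathrm{Cl}_q(\mathfrak{sl}_2)$ is the quotient of the tensor algebra $T(V_{2\pi})$ by the relations $x\otimes y+\tilde\sigma(x\otimes y)=2\langle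 x,y\rangle$; it is a $U_q(\mathfrak{sl}_2)$-module algebra with $E(xy)=x\,(Ey)+(Ex)(Ky)$, $F(xy)=(K^{-1}x)(Fy)+(Fx)\,y$, $K(xy)=(Kx)(Ky)$. The spin modules $S_\pm$ have basis $s_1,s_{-1}$ and $$v_2\mapsto\begin{pmatrix}0&t\\0&0\end{pmatrix},\qquad v_0\mapsto\pm\begin{pmatrix}-t/q^2&0\\0&t\end{pmatrix},\qquad v_{-2}\mapsto\begin{pmatrix}0&0\\t/q&0\end{pmatrix}.$$ *Braided action.* For $M=M_{\lambda\pi}$ or $V_{k\pi}$ let $\sigma_R:\mathrm{Cl}_q(\mathfrak{sl}_2)\otimes M\to M\otimes\mathrm{Cl}_q(\mathfrak{sl}_2)$ be the flip composed with the action of $$R=q^{H\otimes H/2}\sum_{m\ge0}q^{m(m-1)/2}\frac{(q-q^{-1})^m}{[m]_q!}\,E^m\otimes F^m ,$$ where $q^{H\otimes H/2}(x\otimes w)=q^{ab/2}\,x\otimes w$ for $x$ of weight $a$ and $w$ of weight $b$. An element $u\otimes x$ of $U_q(\mathfrak{sl}_2)\otimes\mathrm{Cl}_q(\mathfrak{sl}_2)$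 acts on $M\otimes S_\pm$ by first applying $\sigma_R$ to $x$ and the factor $M$, and then letting $u$ act on $M$ and the Clifford factor act on $S_\pm$. *Dirac operator.* Let $X=E$, $Y=KF$, $Z=q^{-2}EF-FE$, $C=EF+\frac{q^{-1}K+qK^{-1}}{(q-q^{-1})^2}$, and $$D_q=\frac1c\Big(X\otimes v_{-2}+\frac{q}{1+q^2}Z\otimes v_0+\frac1{q^2}Y\otimes v_2\Big)-\frac{(q^2-1)^2}{2q(q^2+1)c^2}\,C\otimes\big(v_2v_0v_{-2}+c\,v_0\big).$$ It acts on $M\otimes S_\pm$ by the braided action, and $H_D(M)=\ker D_q/(\operatorname{im}D_q\cap\ker D_q)$. **Theorem.** For either sign in $S_\pm$: 1. $H_D(V_{k\pi})=0$ for all $k\in\mathbb Z_{\ge0}$. 2. In setting (B), $H_D(M_{\lambda\pi})=0$ for every $\lambda\in\mathbb C\setminus\{-1\}$. In setting (A), $H_D(M_{\lambda\pi})=0$ for every $\lambda\in\mathbb C$ with $[\lambda+1]_q\neq0$, that is, $\lambda\notin -1+\frac{\pi i}{\hbar}\mathbb Z$. 3. For $\lambda=-1$, $D_q(w_{-1}\otimes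 s_1)=0$, and $H_D(M_{-\pi})$ is one-dimensional, spanned by the nonzero class of $w_{-1}\otimes s_1$. 4. For every $\lambda\in\mathbb C$, $D_q(w_\lambda\otimes s_1)=\mp\frac{t}{2c}[\lambda+1]_q\,w_\lambda\otimes s_1$ on $M_{\lambda\pi}\otimes S_\pm$; and for every $m\ge1$ the space $\operatorname{span}(w_{\lambda-2m}\otimes s_1,\;w_{\lambda-2(m-1)}\otimes s_{-1})$ is $D_q$-invariant, and the eigenvalues of $D_q$ on it are exactly $\pm\frac{t}{2c}[\lambda+1]_q$. -/

import Mathlib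

open scoped TensorProduct LaurentSeries

noncomputable section

namespace QDirac

universe u

/-! ### The deformation parameter and complex powers of it -/

/-- A deformation parameter `q` in a field `𝕜`, not a root of unity, together with its
complex powers `q ^ z`. -/
structure QParam (𝕜 : Type*) [Field 𝕜] where
  pow : ℂ → 𝕜
  pow_zero : pow 0 = 1
  pow_add : ∀ a b, pow (a + b) = pow a * pow b
  not_root : ∀ n : ℕ, 0 < n → pow 1 ^ n ≠ 1
  two_ne_zero : (2 : 𝕜) ≠ 0

/-- The numerical parameter `q = e ^ ħ`, with `q ^ z = e ^ (ħ z)`. -/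
def complexParam (ħ : ℂ) (h : ∀ n : ℕ, 0 < n → Complex.exp ħ ^ n ≠ 1) : QParam ℂ where
  pow z := Complex.exp (ħ * z)
  pow_zero := by simp
  pow_add a b := by rw [mul_add, Complex.exp_add]
  not_root := by simpa using h
  two_ne_zero := by norm_num

/-- The formal parameter `q = e ^ ħ`, where `ħ` is the variable of the field `ℂ((ħ))` of formal
Laurent series, with `q ^ z = ∑ n, (z ħ) ^ n / n!`; values are taken in a field extension `𝕜` of
`ℂ((ħ))`, so that square roots may be adjoined. -/
def formalParam (𝕜 : Type*) [Field 𝕜] [Algebra ℂ⸨X⸩ 𝕜] : QParam 𝕜 where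
  pow z := algebraMap ℂ⸨X⸩ 𝕜
    (HahnSeries.ofPowerSeries ℤ ℂ (PowerSeries.rescale z (PowerSeries.exp ℂ)))
  pow_zero := by
    have h : PowerSeries.rescale (0 : ℂ) (PowerSeries.exp ℂ) = 1 := by
      ext n
      rcases n with _ | n <;> simp [PowerSeries.coeff_one]
    rw [h, map_one, map_one]
  pow_add a b := by
    rw [← PowerSeries.exp_mul_exp_eq_exp_add, map_mul, map_mul]
  not_root := by
    intro n hn h
    rw [← map_pow, ← map_pow, PowerSeries.rescale_one, RingHom.id_apply,
      PowerSeries.exp_pow_eq_rescale_exp] at h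
    have h1 := (algebraMap ℂ⸨X⸩ 𝕜).injective (h.trans (map_one _).symm)
    have h2 := HahnSeries.ofPowerSeries_injective (h1.trans (map_one _).symm)
    have h3 := congrArg (PowerSeries.coeff 1) h2
    simp [PowerSeries.coeff_rescale, PowerSeries.coeff_one, PowerSeries.coeff_exp] at h3
    omega
  two_ne_zero := by
    have h := ((algebraMap ℂ⸨X⸩ 𝕜).comp
      (HahnSeries.C : ℂ →+* ℂ⸨X⸩)).injective.ne (by norm_num : (2 : ℂ) ≠ 0)
    rwa [map_ofNat, map_zero] at h

variable {𝕜 : Type u} [Field 𝕜] (p : QParam 𝕜) (c : 𝕜)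

namespace QParam

/-- The parameter `q` itself. -/
def q : 𝕜 := p.pow 1

/-- The quantum number `[z]_q = (q ^ z - q ^ (-z)) / (q - q ^ (-1))`. -/
def qnum (z : ℂ) : 𝕜 := (p.pow z - p.pow (-z)) / (p.q - p.q⁻¹)

/-- The quantum factorial `[m]_q!`. -/
def qfact (m : ℕ) : 𝕜 := ∏ i ∈ Finset.range m, p.qnum ((i : ℂ) + 1)

theorem pow_mul_neg (z : ℂ) : p.pow z * p.pow (-z) = 1 := by
  rw [← p.pow_add, add_neg_cancel, p.pow_zero]

theorem pow_ne_zero (z : ℂ) : p.pow z ≠ 0 :=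
  left_ne_zero_of_mul_eq_one (p.pow_mul_neg z)

theorem pow_neg (z : ℂ) : p.pow (-z) = (p.pow z)⁻¹ :=
  eq_inv_of_mul_eq_one_right (p.pow_mul_neg z)

theorem q_ne_zero : p.q ≠ 0 := p.pow_ne_zero 1

theorem q_sq_sub_one : p.q ^ 2 - 1 ≠ 0 := sub_ne_zero.2 (p.not_root 2 (by norm_num))

theorem q_sub_inv : p.q - p.q⁻¹ ≠ 0 := by
  intro h
  apply p.q_sq_sub_one
  have := p.q_ne_zero
  field_simp at h
  simpa using h

theorem q_sq_add_one : p.q ^ 2 + 1 ≠ 0 := by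
  intro h
  apply p.not_root 4 (by norm_num)
  change p.q ^ 4 = 1
  linear_combination (p.q ^ 2 - 1) * h

theorem q_four_add_one : p.q ^ 4 + 1 ≠ 0 := by
  intro h
  apply p.not_root 8 (by norm_num)
  change p.q ^ 8 = 1
  linear_combination (p.q ^ 4 - 1) * h

theorem q_cyc : p.q ^ 4 + p.q ^ 2 + 1 ≠ 0 := by
  intro h
  apply p.not_root 6 (by norm_num)
  change p.q ^ 6 = 1
  linear_combination (p.q ^ 2 - 1) * h

/-- `q ^ z` as a unit. -/
def powUnit (z : ℂ) : 𝕜ˣ := Units.mk0 (p.pow z) (p.pow_ne_zero z)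

end QParam

/-! ### The quantum group `U_q(sl₂)` -/

/-- The generators `E`, `F`, `K`, `K⁻¹`. -/
inductive UqGen : Type
  | E | F | K | Kinv

/-- The defining relations of `U_q(sl₂)`. -/
inductive UqRel : FreeAlgebra 𝕜 UqGen → FreeAlgebra 𝕜 UqGen → Prop
  | KE : UqRel (FreeAlgebra.ι 𝕜 .K * FreeAlgebra.ι 𝕜 .E)
      (p.q ^ 2 • (FreeAlgebra.ι 𝕜 .E * FreeAlgebra.ι 𝕜 .K))
  | KF : UqRel (FreeAlgebra.ι 𝕜 .K * FreeAlgebra.ι 𝕜 .F)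
      ((p.q ^ 2)⁻¹ • (FreeAlgebra.ι 𝕜 .F * FreeAlgebra.ι 𝕜 .K))
  | KKinv : UqRel (FreeAlgebra.ι 𝕜 .K * FreeAlgebra.ι 𝕜 .Kinv) 1
  | KinvK : UqRel (FreeAlgebra.ι 𝕜 .Kinv * FreeAlgebra.ι 𝕜 .K) 1
  | EF : UqRel (FreeAlgebra.ι 𝕜 .E * FreeAlgebra.ι 𝕜 .F - FreeAlgebra.ι 𝕜 .F * FreeAlgebra.ι 𝕜 .E)
      ((p.q - p.q⁻¹)⁻¹ • (FreeAlgebra.ι 𝕜 .K - FreeAlgebra.ι 𝕜 .Kinv))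

/-- The algebra `U_q(sl₂)`. -/
def Uq : Type _ := RingQuot (UqRel p)

instance : Ring (Uq p) := inferInstanceAs (Ring (RingQuot (UqRel p)))

instance : Algebra 𝕜 (Uq p) := inferInstanceAs (Algebra 𝕜 (RingQuot (UqRel p)))

/-- A generator, as an element of `U_q(sl₂)`. -/
def Uq.gen (g : UqGen) : Uq p :=
  (RingQuot.mkAlgHom 𝕜 (UqRel p) (FreeAlgebra.ι 𝕜 g) : RingQuot (UqRel p))

/-- The representation of `U_q(sl₂)` given by the operators of the four generators. -/
def Uq.rep {M : Type*} [AddCommGroup M] [Module 𝕜 M] (E F K L : Module.End 𝕜 M)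
    (hKE : K * E = p.q ^ 2 • (E * K)) (hKF : K * F = (p.q ^ 2)⁻¹ • (F * K))
    (hKL : K * L = 1) (hLK : L * K = 1)
    (hEF : E * F - F * E = (p.q - p.q⁻¹)⁻¹ • (K - L)) : Uq p →ₐ[𝕜] Module.End 𝕜 M :=
  RingQuot.liftAlgHom 𝕜 ⟨FreeAlgebra.lift 𝕜 (fun
    | .E => E
    | .F => F
    | .K => K
    | .Kinv => L), by
      intro x y h
      induction h <;> simp [hKE, hKF, hKL, hLK, hEF]⟩

theorem Uq.rep_gen {M : Type*} [AddCommGroup M] [Module 𝕜 M] (E F K L : Module.End 𝕜 M)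
    (hKE : K * E = p.q ^ 2 • (E * K)) (hKF : K * F = (p.q ^ 2)⁻¹ • (F * K))
    (hKL : K * L = 1) (hLK : L * K = 1)
    (hEF : E * F - F * E = (p.q - p.q⁻¹)⁻¹ • (K - L)) (g : UqGen) :
    Uq.rep p E F K L hKE hKF hKL hLK hEF (Uq.gen p g) = (match g with
      | .E => E
      | .F => F
      | .K => K
      | .Kinv => L) := by
  exact (RingQuot.liftAlgHom_mkAlgHom_apply ..).trans (FreeAlgebra.lift_ι_apply ..)

/-- `X = v₂ = E`. -/
def Uq.X : Uq p := Uq.gen p .E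

/-- `Z = v₀ = q⁻² E F - F E`. -/
def Uq.Z : Uq p :=
  (p.q ^ 2)⁻¹ • (Uq.gen p .E * Uq.gen p .F) - Uq.gen p .F * Uq.gen p .E

/-- `Y = v₋₂ = K F`. -/
def Uq.Y : Uq p := Uq.gen p .K * Uq.gen p .F

/-- The quantum Casimir element `C = E F + (q⁻¹ K + q K⁻¹) / (q - q⁻¹)²`. -/
def Uq.C : Uq p :=
  Uq.gen p .E * Uq.gen p .F +
    ((p.q - p.q⁻¹) ^ 2)⁻¹ • (p.q⁻¹ • Uq.gen p .K + p.q • Uq.gen p .Kinv)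

/-! ### The `q`-deformed Clifford algebra

The basis `v₂, v₀, v₋₂` of the quantized adjoint module `V_{2π}` is indexed by `0, 1, 2 : Fin 3`.
A tensor in `V_{2π} ⊗ V_{2π}` is given by the matrix of its coefficients. -/

/-- The coefficients of `σ̃ (v_i ⊗ v_j)`, where `σ̃` is the normalized braiding of
`V_{2π} ⊗ V_{2π} = V_{4π} ⊕ V_{2π} ⊕ V_0`, that is, the linear map equal to `1` on `V_{4π} ⊕ V_0`
and to `-1` on `V_{2π}` (see `normBraid_sym` and `normBraid_skew`). -/
def normBraid (q : 𝕜) : Fin 3 → Fin 3 → Matrix (Fin 3) (Fin 3) 𝕜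
  | 0, 0 => !![1, 0, 0; 0, 0, 0; 0, 0, 0]
  | 0, 1 => (q ^ 4 + 1)⁻¹ • !![0, 1 - q ^ 4, 0; 2 * q ^ 2, 0, 0; 0, 0, 0]
  | 0, 2 => (q ^ 4 + 1)⁻¹ • !![0, 0, (q ^ 2 - 1) ^ 2;
      0, 2 * q ^ 3 * (q ^ 2 - 1) / (q ^ 2 + 1), 0; 2 * q ^ 2, 0, 0]
  | 1, 0 => (q ^ 4 + 1)⁻¹ • !![0, 2 * q ^ 2, 0; q ^ 4 - 1, 0, 0; 0, 0, 0]
  | 1, 1 => (q ^ 4 + 1)⁻¹ • !![0, 0, 2 * (q ^ 4 - 1) / q;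
      0, -q ^ 4 + 4 * q ^ 2 - 1, 0; -(2 * (q ^ 4 - 1) / q), 0, 0]
  | 1, 2 => (q ^ 4 + 1)⁻¹ • !![0, 0, 0; 0, 0, 1 - q ^ 4; 0, 2 * q ^ 2, 0]
  | 2, 0 => (q ^ 4 + 1)⁻¹ • !![0, 0, 2 * q ^ 2;
      0, -(2 * q ^ 3 * (q ^ 2 - 1) / (q ^ 2 + 1)), 0; (q ^ 2 - 1) ^ 2, 0, 0]
  | 2, 1 => (q ^ 4 + 1)⁻¹ • !![0, 0, 0; 0, 0, 2 * q ^ 2; 0, q ^ 4 - 1, 0]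
  | 2, 2 => !![0, 0, 0; 0, 0, 0; 0, 0, 1]

/-- Six tensors spanning `V_{4π} ⊕ V_0`; the first five span `V_{4π}`. -/
def symTensor (q : 𝕜) : Fin 6 → Matrix (Fin 3) (Fin 3) 𝕜 :=
  ![!![1, 0, 0; 0, 0, 0; 0, 0, 0],
    !![0, -1 / q ^ 2, 0; -1, 0, 0; 0, 0, 0],
    !![0, 0, (-q ^ 2 - 1) / q ^ 5; 0, (q ^ 2 + 1) / q ^ 2, 0; (-q ^ 2 - 1) / q, 0, 0],
    !![0, 0, 0; 0, 0, (q ^ 2 + 1) * (q ^ 4 + q ^ 2 + 1) / q ^ 5;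
      0, (q ^ 6 + 2 * q ^ 4 + 2 * q ^ 2 + 1) / q ^ 3, 0],
    !![0, 0, 0; 0, 0, 0; 0, 0, (q ^ 2 + 1) ^ 2 * (q ^ 4 + 1) * (q ^ 4 + q ^ 2 + 1) / q ^ 6],
    !![0, 0, (q ^ 2 + 1) / q; 0, 1, 0; (q ^ 2 + 1) / q ^ 3, 0, 0]]

/-- Three tensors spanning `V_{2π} ⊆ V_{2π} ⊗ V_{2π}`. -/
def skewTensor (q : 𝕜) : Fin 3 → Matrix (Fin 3) (Fin 3) 𝕜 :=
  ![!![0, -q ^ 2, 0; 1, 0, 0; 0, 0, 0],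
    !![0, 0, (-q ^ 2 - 1) / q; 0, q ^ 2 - 1, 0; (q ^ 2 + 1) / q, 0, 0],
    !![0, 0, 0; 0, 0, q * (q ^ 2 + 1); 0, (-q ^ 2 - 1) / q, 0]]

theorem normBraid_sym (a : Fin 6) :
    ∑ i, ∑ j, symTensor p.q a i j • normBraid p.q i j = symTensor p.q a := by
  have hq := p.q_ne_zero
  have h1 := p.q_sq_add_one
  have h2 := p.q_four_add_one
  fin_cases a <;>
    simp only [Fin.sum_univ_three, normBraid, symTensor, Fin.zero_eta, Fin.mk_one,
      Fin.reduceFinMk, Matrix.cons_val, Matrix.of_apply, zero_smul, one_smul, add_zero, zero_add,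
      Matrix.smul_of, Matrix.smul_cons, Matrix.smul_empty, Matrix.of_add_of, Matrix.add_cons,
      Matrix.head_cons, Matrix.tail_cons, Matrix.empty_add_empty, smul_eq_mul, mul_zero,
      mul_one] <;>
    congr! 1 <;> simp <;> field_simp <;> ring_nf
  all_goals simp only [and_self]

theorem normBraid_skew (a : Fin 3) :
    ∑ i, ∑ j, skewTensor p.q a i j • normBraid p.q i j = -skewTensor p.q a := by
  have hq := p.q_ne_zero
  have h1 := p.q_sq_add_one
  have h2 := p.q_four_add_one
  fin_cases a <;>
    simp only [Fin.sum_univ_three, normBraid, skewTensor, Fin.zero_eta, Fin.mk_one,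
      Fin.reduceFinMk, Matrix.cons_val, Matrix.of_apply, zero_smul, one_smul, add_zero, zero_add,
      Matrix.smul_of, Matrix.smul_cons, Matrix.smul_empty, Matrix.of_add_of, Matrix.add_cons,
      Matrix.head_cons, Matrix.tail_cons, Matrix.empty_add_empty, smul_eq_mul, mul_zero,
      Matrix.neg_of, Matrix.neg_cons, Matrix.neg_empty] <;>
    congr! 1 <;> simp <;> field_simp <;> ring_nf
  all_goals simp only [and_self]

/-- The invariant bilinear form on `V_{2π}`, normalized by `⟨v₂, v₋₂⟩ = c`. -/
def form (q c : 𝕜) : Matrix (Fin 3) (Fin 3) 𝕜 :=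
  !![0, 0, c; 0, (1 + q ^ 2) * c / q ^ 3, 0; c / q ^ 2, 0, 0]

/-- The relations `x ⊗ y + σ̃ (x ⊗ y) = 2 ⟨x, y⟩` for basis vectors `x = v_i`, `y = v_j`. -/
inductive ClRel : FreeAlgebra 𝕜 (Fin 3) → FreeAlgebra 𝕜 (Fin 3) → Prop
  | mk (i j : Fin 3) : ClRel
      (FreeAlgebra.ι 𝕜 i * FreeAlgebra.ι 𝕜 j +
        ∑ k, ∑ l, normBraid p.q i j k l • (FreeAlgebra.ι 𝕜 k * FreeAlgebra.ι 𝕜 l))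
      (algebraMap 𝕜 _ (2 * form p.q c i j))

/-- The `q`-deformed Clifford algebra `Cl_q(sl₂)`, a quotient of the tensor algebra of `V_{2π}`. -/
def Cl : Type _ := RingQuot (ClRel p c)

instance : Ring (Cl p c) := inferInstanceAs (Ring (RingQuot (ClRel p c)))

instance : Algebra 𝕜 (Cl p c) := inferInstanceAs (Algebra 𝕜 (RingQuot (ClRel p c)))

namespace Cl

/-- The quotient map. -/
def mk : FreeAlgebra 𝕜 (Fin 3) →ₐ[𝕜] Cl p c := RingQuot.mkAlgHom 𝕜 (ClRel p c)

/-- The generators `v₂ = v 0`, `v₀ = v 1`, `v₋₂ = v 2`. -/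
def v (i : Fin 3) : Cl p c := mk p c (FreeAlgebra.ι 𝕜 i)

theorem rel (i j : Fin 3) :
    v p c i * v p c j + ∑ k, ∑ l, normBraid p.q i j k l • (v p c k * v p c l) =
      algebraMap 𝕜 _ (2 * form p.q c i j) := by
  have h : mk p c _ = mk p c _ := RingQuot.mkAlgHom_rel 𝕜 (ClRel.mk (p := p) (c := c) i j)
  simp only [map_add, map_mul (mk p c), map_sum, map_smul, AlgHom.commutes] at h
  exact h

@[elab_as_elim]
theorem induction {P : Cl p c → Prop} (x : Cl p c)
    (scalar : ∀ r : 𝕜, P (algebraMap 𝕜 (Cl p c) r)) (gen : ∀ i, P (v p c i))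
    (mul : ∀ x y, P x → P y → P (x * y)) (add : ∀ x y, P x → P y → P (x + y)) : P x := by
  obtain ⟨y, rfl⟩ : ∃ y, mk p c y = x := RingQuot.mkAlgHom_surjective 𝕜 (ClRel p c) x
  induction y using FreeAlgebra.induction with
  | grade0 r => simpa using scalar r
  | grade1 i => exact gen i
  | mul a b ha hb => rw [map_mul (mk p c)]; exact mul _ _ ha hb
  | add a b ha hb => rw [map_add]; exact add _ _ ha hb

section lift

variable {A : Type*} [Ring A] [Algebra 𝕜 A]

/-- The algebra homomorphism `Cl_q(sl₂) → A` given by images of `v₂, v₀, v₋₂`. -/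
def lift (a : Fin 3 → A)
    (h : ∀ i j, a i * a j + ∑ k, ∑ l, normBraid p.q i j k l • (a k * a l) =
      algebraMap 𝕜 A (2 * form p.q c i j)) : Cl p c →ₐ[𝕜] A :=
  RingQuot.liftAlgHom 𝕜 ⟨FreeAlgebra.lift 𝕜 a, by
    intro x y hxy
    obtain ⟨i, j⟩ := hxy
    simpa only [map_add, map_mul (FreeAlgebra.lift 𝕜 a), map_sum, map_smul, AlgHom.commutes,
      FreeAlgebra.lift_ι_apply] using h i j⟩

theorem lift_v (a : Fin 3 → A) (h) (i : Fin 3) : lift p c a h (v p c i) = a i := by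
  exact (RingQuot.liftAlgHom_mkAlgHom_apply ..).trans (FreeAlgebra.lift_ι_apply ..)

end lift

/-- The weight of `v_i` is `2 * wt i`: the vectors `v₂, v₀, v₋₂` have weights `2, 0, -2`. -/
def wt : Fin 3 → ℤ := ![1, 0, -1]

theorem torus_rel (u : 𝕜ˣ) (i j : Fin 3) :
    ((u ^ wt i : 𝕜ˣ) : 𝕜) • v p c i * ((u ^ wt j : 𝕜ˣ) : 𝕜) • v p c j +
      ∑ k, ∑ l, normBraid p.q i j k l •
        (((u ^ wt k : 𝕜ˣ) : 𝕜) • v p c k * ((u ^ wt l : 𝕜ˣ) : 𝕜) • v p c l) =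
      algebraMap 𝕜 _ (2 * form p.q c i j) := by
  have h := congrArg (fun z => (((u ^ wt i : 𝕜ˣ) : 𝕜) * ((u ^ wt j : 𝕜ˣ) : 𝕜)) • z) (rel p c i j)
  simp only [smul_add, Finset.smul_sum] at h
  rw [smul_mul_smul_comm]
  have hu := u.ne_zero
  convert h using 1
  · congr 1
    refine Finset.sum_congr rfl fun k _ => Finset.sum_congr rfl fun l _ => ?_
    rw [smul_mul_smul_comm, smul_smul, smul_smul]
    congr 1
    fin_cases i <;> fin_cases j <;> fin_cases k <;> fin_cases l <;>
      simp [normBraid, wt, hu, mul_comm]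
  · rw [Algebra.algebraMap_eq_smul_one, smul_smul]
    congr 1
    fin_cases i <;> fin_cases j <;> simp [form, wt, hu]

/-- The operator `u ^ (H / 2)` on `Cl_q(sl₂)`: the algebra endomorphism multiplying each vector of
weight `2 n` by `u ^ n`. -/
def torus (u : 𝕜ˣ) : Cl p c →ₐ[𝕜] Cl p c :=
  lift p c (fun i => ((u ^ wt i : 𝕜ˣ) : 𝕜) • v p c i) (torus_rel p c u)

theorem torus_v (u : 𝕜ˣ) (i : Fin 3) :
    torus p c u (v p c i) = ((u ^ wt i : 𝕜ˣ) : 𝕜) • v p c i := lift_v ..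

/-- The action of `K` on `Cl_q(sl₂)`. -/
def actK : Cl p c →ₐ[𝕜] Cl p c := torus p c (p.powUnit 2)

/-- The action of `K⁻¹` on `Cl_q(sl₂)`. -/
def actKinv : Cl p c →ₐ[𝕜] Cl p c := torus p c (p.powUnit (-2))

/-- The quantized adjoint action of `E` on `v₂, v₀, v₋₂`. -/
def adE : Fin 3 → Cl p c := ![0, (-(p.q + p.q⁻¹)) • v p c 0, v p c 1]

/-- The quantized adjoint action of `F` on `v₂, v₀, v₋₂`. -/
def adF : Fin 3 → Cl p c := ![-v p c 1, (p.q + p.q⁻¹) • v p c 2, 0]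

theorem powUnit_two : ((p.powUnit 2 : 𝕜ˣ) : 𝕜) = p.q ^ 2 := by
  rw [QParam.powUnit, Units.val_mk0, QParam.q, sq, ← p.pow_add]
  norm_num

theorem powUnit_neg_two : ((p.powUnit (-2) : 𝕜ˣ) : 𝕜) = (p.q ^ 2)⁻¹ := by
  rw [QParam.powUnit, Units.val_mk0, QParam.pow_neg, QParam.q, sq, ← p.pow_add]
  norm_num

/-- The algebra homomorphism `x ↦ (L x, D x; 0, K x)` to upper triangular matrices which encodes
a linear map `D` with `D (x y) = L x * D y + D x * K y`. -/
def skew (L K : Cl p c →ₐ[𝕜] Cl p c) (D : Fin 3 → Cl p c)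
    (h : ∀ i j, L (v p c i) * D j + D i * K (v p c j) + ∑ k, ∑ l, normBraid p.q i j k l •
      (L (v p c k) * D l + D k * K (v p c l)) = 0) :
    Cl p c →ₐ[𝕜] Matrix (Fin 2) (Fin 2) (Cl p c) :=
  lift p c (fun i => !![L (v p c i), D i; 0, K (v p c i)]) (by
    intro i j
    have h1 := congrArg L (rel p c i j)
    have h2 := congrArg K (rel p c i j)
    simp only [map_add, map_mul L, map_mul K, map_sum, map_smul, AlgHom.commutes] at h1 h2
    ext a b
    fin_cases a <;> fin_cases b
    · simpa [Matrix.mul_apply, Matrix.sum_apply, Matrix.algebraMap_matrix_apply] using h1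
    · simpa [Matrix.mul_apply, Matrix.sum_apply, Matrix.algebraMap_matrix_apply] using h i j
    · simp [Matrix.sum_apply, Matrix.algebraMap_matrix_apply]
    · simpa [Matrix.mul_apply, Matrix.sum_apply, Matrix.algebraMap_matrix_apply] using h2)

theorem skew_v (L K : Cl p c →ₐ[𝕜] Cl p c) (D : Fin 3 → Cl p c) (h) (i : Fin 3) :
    skew p c L K D h (v p c i) = !![L (v p c i), D i; 0, K (v p c i)] := lift_v ..

theorem skew_apply (L K : Cl p c →ₐ[𝕜] Cl p c) (D : Fin 3 → Cl p c) (h) (x : Cl p c) :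
    skew p c L K D h x = !![L x, skew p c L K D h x 0 1; 0, K x] := by
  induction x using Cl.induction with
  | scalar r =>
    ext a b
    fin_cases a <;> fin_cases b <;> simp [Matrix.algebraMap_matrix_apply]
  | gen i => simp [skew_v]
  | mul x y hx hy =>
    rw [map_mul, hx, hy]
    ext a b
    fin_cases a <;> fin_cases b <;> simp [Matrix.mul_apply]
  | add x y hx hy =>
    rw [map_add, hx, hy]
    ext a b
    fin_cases a <;> fin_cases b <;> simp

/-- The linear map `D` with `D (x y) = L x * D y + D x * K y` and given values on generators. -/
def skewDer (L K : Cl p c →ₐ[𝕜] Cl p c) (D : Fin 3 → Cl p c)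
    (h : ∀ i j, L (v p c i) * D j + D i * K (v p c j) + ∑ k, ∑ l, normBraid p.q i j k l •
      (L (v p c k) * D l + D k * K (v p c l)) = 0) : Cl p c →ₗ[𝕜] Cl p c where
  toFun x := skew p c L K D h x 0 1
  map_add' x y := by simp
  map_smul' r x := by simp

theorem skewDer_v (L K : Cl p c →ₐ[𝕜] Cl p c) (D : Fin 3 → Cl p c) (h) (i : Fin 3) :
    skewDer p c L K D h (v p c i) = D i := by simp [skewDer, skew_v]

theorem skewDer_mul (L K : Cl p c →ₐ[𝕜] Cl p c) (D : Fin 3 → Cl p c) (h) (x y : Cl p c) :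
    skewDer p c L K D h (x * y) =
      L x * skewDer p c L K D h y + skewDer p c L K D h x * K y := by
  simp only [skewDer, LinearMap.coe_mk, AddHom.coe_mk, map_mul]
  rw [skew_apply p c L K D h x, skew_apply p c L K D h y]
  simp [Matrix.mul_apply]

theorem skewDer_algebraMap (L K : Cl p c →ₐ[𝕜] Cl p c) (D : Fin 3 → Cl p c) (h) (r : 𝕜) :
    skewDer p c L K D h (algebraMap 𝕜 _ r) = 0 := by
  simp [skewDer, Matrix.algebraMap_matrix_apply]

theorem r00 : v p c 0 * v p c 0 = 0 := by
  have h := rel p c 0 0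
  simp [Fin.sum_univ_three, normBraid, form] at h
  have h2 : (2 : 𝕜) • (v p c 0 * v p c 0) = 0 := by rw [two_smul]; exact h
  exact (smul_eq_zero.1 h2).resolve_left p.two_ne_zero

theorem r22 : v p c 2 * v p c 2 = 0 := by
  have h := rel p c 2 2
  simp [Fin.sum_univ_three, normBraid, form] at h
  have h2 : (2 : 𝕜) • (v p c 2 * v p c 2) = 0 := by rw [two_smul]; exact h
  exact (smul_eq_zero.1 h2).resolve_left p.two_ne_zero

theorem r10 : v p c 1 * v p c 0 = -((p.q ^ 2)⁻¹ • (v p c 0 * v p c 1)) := by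
  have h := rel p c 1 0
  simp [Fin.sum_univ_three, normBraid, form] at h
  have := p.two_ne_zero
  have := p.q_ne_zero
  have := p.q_four_add_one
  linear_combination (norm := (match_scalars <;> field_simp <;> ring))
    ((p.q ^ 4 + 1) / (2 * p.q ^ 4)) • h

theorem r21 : v p c 2 * v p c 1 = -((p.q ^ 2)⁻¹ • (v p c 1 * v p c 2)) := by
  have h := rel p c 2 1
  simp [Fin.sum_univ_three, normBraid, form] at h
  have := p.two_ne_zero
  have := p.q_ne_zero
  have := p.q_four_add_one
  linear_combination (norm := (match_scalars <;> field_simp <;> ring))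
    ((p.q ^ 4 + 1) / (2 * p.q ^ 4)) • h

theorem r11 : v p c 1 * v p c 1 =
    ((1 - p.q ^ 4) / p.q ^ 3) • (v p c 0 * v p c 2) + ((p.q ^ 2 + 1) / p.q * c) • 1 := by
  have h := rel p c 1 1
  have h' := rel p c 0 2
  rw [Algebra.algebraMap_eq_smul_one] at h h'
  simp [Fin.sum_univ_three, normBraid, form] at h h'
  have := p.two_ne_zero
  have := p.q_ne_zero
  have := p.q_sq_add_one
  have := p.q_four_add_one
  linear_combination (norm := (match_scalars <;> field_simp <;> ring))
    (2 : 𝕜)⁻¹ • h + ((p.q ^ 4 - 1) / (2 * p.q ^ 3)) • h'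

theorem r20 : v p c 2 * v p c 0 =
    -(v p c 0 * v p c 2) + ((p.q ^ 2 + 1) / p.q ^ 2 * c) • 1 := by
  have h := rel p c 1 1
  have h' := rel p c 0 2
  rw [Algebra.algebraMap_eq_smul_one] at h h'
  simp [Fin.sum_univ_three, normBraid, form] at h h'
  have := p.two_ne_zero
  have := p.q_ne_zero
  have := p.q_sq_add_one
  have := p.q_four_add_one
  linear_combination (norm := (match_scalars <;> field_simp <;> ring))
    h' - (p.q * (p.q ^ 2 - 1) / (2 * (p.q ^ 2 + 1))) • h

theorem adE_rel (i j : Fin 3) :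
    AlgHom.id 𝕜 _ (v p c i) * adE p c j + adE p c i * actK p c (v p c j) +
      ∑ k, ∑ l, normBraid p.q i j k l •
        (AlgHom.id 𝕜 _ (v p c k) * adE p c l + adE p c k * actK p c (v p c l)) = 0 := by
  have hq := p.q_ne_zero
  have h1 := p.q_sq_add_one
  have h2 := p.q_four_add_one
  fin_cases i <;> fin_cases j <;>
    simp [Fin.sum_univ_three, normBraid, actK, torus_v, wt, powUnit_two, adE,
      r00, r10, r21, r11, r20] <;>
    match_scalars <;> field_simp <;> ring

theorem adF_rel (i j : Fin 3) :
    actKinv p c (v p c i) * adF p c j + adF p c i * AlgHom.id 𝕜 _ (v p c j) +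
      ∑ k, ∑ l, normBraid p.q i j k l •
        (actKinv p c (v p c k) * adF p c l + adF p c k * AlgHom.id 𝕜 _ (v p c l)) = 0 := by
  have hq := p.q_ne_zero
  have h1 := p.q_sq_add_one
  have h2 := p.q_four_add_one
  fin_cases i <;> fin_cases j <;>
    simp [Fin.sum_univ_three, normBraid, actKinv, torus_v, wt, powUnit_neg_two, adF,
      r22, r10, r21, r11, r20] <;>
    match_scalars <;> field_simp <;> ring

/-- The action of `E` on `Cl_q(sl₂)`: `E (x y) = x * E y + E x * K y`. -/
def actE : Cl p c →ₗ[𝕜] Cl p c :=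
  skewDer p c (AlgHom.id 𝕜 _) (actK p c) (adE p c) (adE_rel p c)

/-- The action of `F` on `Cl_q(sl₂)`: `F (x y) = K⁻¹ x * F y + F x * y`. -/
def actF : Cl p c →ₗ[𝕜] Cl p c :=
  skewDer p c (actKinv p c) (AlgHom.id 𝕜 _) (adF p c) (adF_rel p c)

theorem actE_mul (x y : Cl p c) :
    actE p c (x * y) = x * actE p c y + actE p c x * actK p c y := skewDer_mul ..

theorem actF_mul (x y : Cl p c) :
    actF p c (x * y) = actKinv p c x * actF p c y + actF p c x * y := skewDer_mul ..

theorem actE_v (i : Fin 3) : actE p c (v p c i) = adE p c i := skewDer_v ..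

theorem actF_v (i : Fin 3) : actF p c (v p c i) = adF p c i := skewDer_v ..

theorem actE_algebraMap (r : 𝕜) : actE p c (algebraMap 𝕜 _ r) = 0 := skewDer_algebraMap ..

theorem actF_algebraMap (r : 𝕜) : actF p c (algebraMap 𝕜 _ r) = 0 := skewDer_algebraMap ..

theorem actK_v (i : Fin 3) : actK p c (v p c i) = ((p.q ^ 2) ^ wt i) • v p c i := by
  rw [actK, torus_v, Units.val_zpow_eq_zpow_val, powUnit_two]

theorem actKinv_v (i : Fin 3) : actKinv p c (v p c i) = ((p.q ^ 2)⁻¹ ^ wt i) • v p c i := by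
  rw [actKinv, torus_v, Units.val_zpow_eq_zpow_val, powUnit_neg_two]

theorem actK_actKinv (x : Cl p c) : actK p c (actKinv p c x) = x := by
  have := p.q_ne_zero
  induction x using Cl.induction with
  | scalar r => simp
  | gen i => fin_cases i <;> simp [actK_v, actKinv_v, wt, smul_smul, this]
  | mul x y hx hy => rw [map_mul, map_mul, hx, hy]
  | add x y hx hy => rw [map_add, map_add, hx, hy]

theorem actKinv_actK (x : Cl p c) : actKinv p c (actK p c x) = x := by
  have := p.q_ne_zero
  induction x using Cl.induction with
  | scalar r => simp
  | gen i => fin_cases i <;> simp [actK_v, actKinv_v, wt, smul_smul, this]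
  | mul x y hx hy => rw [map_mul, map_mul, hx, hy]
  | add x y hx hy => rw [map_add, map_add, hx, hy]

theorem actK_actE (x : Cl p c) : actK p c (actE p c x) = p.q ^ 2 • actE p c (actK p c x) := by
  have := p.q_ne_zero
  induction x using Cl.induction with
  | scalar r => simp [actE_algebraMap]
  | gen i =>
    fin_cases i <;> simp [actK_v, actE_v, adE, wt, smul_smul, this, mul_comm]
  | mul x y hx hy =>
    simp only [actE_mul, map_add, map_mul, hx, hy, smul_add, smul_mul_assoc, mul_smul_comm]
  | add x y hx hy => simp only [map_add, hx, hy, smul_add]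

theorem actK_actF (x : Cl p c) :
    actK p c (actF p c x) = (p.q ^ 2)⁻¹ • actF p c (actK p c x) := by
  have := p.q_ne_zero
  induction x using Cl.induction with
  | scalar r => simp [actF_algebraMap]
  | gen i =>
    fin_cases i <;> simp [actK_v, actF_v, adF, wt, smul_smul, this, mul_comm]
  | mul x y hx hy =>
    simp only [actF_mul, map_add, map_mul, hx, hy, smul_add, smul_mul_assoc, mul_smul_comm,
      actK_actKinv, actKinv_actK]
  | add x y hx hy => simp only [map_add, hx, hy, smul_add]

theorem actE_actKinv (x : Cl p c) :
    actE p c (actKinv p c x) = p.q ^ 2 • actKinv p c (actE p c x) := by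
  have h := congrArg (actKinv p c) (actK_actE p c (actKinv p c x))
  rw [actKinv_actK, map_smul, actK_actKinv] at h
  exact h

theorem act_EF (x : Cl p c) : actE p c (actF p c x) - actF p c (actE p c x) =
    (p.q - p.q⁻¹)⁻¹ • (actK p c x - actKinv p c x) := by
  have hq := p.q_ne_zero
  have hq2 := p.q_sub_inv
  have hq1 := p.q_sq_sub_one
  have hqq : p.q - p.q⁻¹ = (p.q ^ 2 - 1) / p.q := by field_simp
  induction x using Cl.induction with
  | scalar r => simp [actE_algebraMap, actF_algebraMap]
  | gen i =>
    rw [hqq]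
    fin_cases i <;> simp [actK_v, actKinv_v, actE_v, actF_v, adE, adF, wt] <;>
      match_scalars <;> field_simp <;> ring
  | mul x y hx hy =>
    have e1 : actE p c (actF p c y) = actF p c (actE p c y) +
      (p.q - p.q⁻¹)⁻¹ • (actK p c y - actKinv p c y) := by rw [← hy]; abel
    have e2 : actE p c (actF p c x) = actF p c (actE p c x) +
      (p.q - p.q⁻¹)⁻¹ • (actK p c x - actKinv p c x) := by rw [← hx]; abel
    simp only [actE_mul, actF_mul, map_add, e1, e2, actE_actKinv, actK_actF, map_mul,
      smul_mul_assoc, mul_smul_comm, smul_smul, mul_add, add_mul, mul_sub, sub_mul, smul_sub]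
    rw [inv_mul_cancel₀ (pow_ne_zero 2 hq)]
    module
  | add x y hx hy =>
    simp only [map_add, smul_sub, smul_add] at *
    linear_combination (norm := module) hx + hy

/-- The `U_q(sl₂)`-module structure of `Cl_q(sl₂)`. -/
def rep : Uq p →ₐ[𝕜] Module.End 𝕜 (Cl p c) :=
  Uq.rep p (actE p c) (actF p c) (actK p c).toLinearMap (actKinv p c).toLinearMap
    (LinearMap.ext (actK_actE p c)) (LinearMap.ext (actK_actF p c))
    (LinearMap.ext (actK_actKinv p c)) (LinearMap.ext (actKinv_actK p c))
    (LinearMap.ext (act_EF p c))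

/-- The matrices by which `v₂, v₀, v₋₂` act on the spin module `S_±` in the basis `s₁, s₋₁`;
the sign `ε = ±1` selects `S_±`. -/
def spinMat (t : 𝕜) (ε : ℤˣ) : Fin 3 → Matrix (Fin 2) (Fin 2) 𝕜 :=
  ![!![0, t; 0, 0],
    !![-((ε : ℤ) : 𝕜) * (t / p.q ^ 2), 0; 0, ((ε : ℤ) : 𝕜) * t],
    !![0, 0; t / p.q, 0]]

theorem spinMat_rel (t : 𝕜) (ht : t ^ 2 = c * (p.q ^ 2 + 1) / p.q) (ε : ℤˣ) (i j : Fin 3) :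
    spinMat p t ε i * spinMat p t ε j +
      ∑ k, ∑ l, normBraid p.q i j k l • (spinMat p t ε k * spinMat p t ε l) =
      algebraMap 𝕜 _ (2 * form p.q c i j) := by
  have hq := p.q_ne_zero
  have h1 := p.q_sq_add_one
  have h2 := p.q_four_add_one
  have hc : c = t ^ 2 * p.q / (p.q ^ 2 + 1) := by rw [ht]; field_simp
  have hε : ((ε : ℤ) : 𝕜) = 1 ∨ ((ε : ℤ) : 𝕜) = -1 := by
    rcases Int.units_eq_one_or ε with rfl | rfl <;> simp
  subst hc
  rcases hε with hε | hε <;> fin_cases i <;> fin_cases j <;>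
    simp only [Fin.sum_univ_three, normBraid, form, spinMat, hε, Fin.zero_eta, Fin.mk_one,
      Fin.reduceFinMk, Matrix.cons_val, Matrix.of_apply, Matrix.smul_of, Matrix.smul_cons,
      Matrix.smul_empty, smul_eq_mul, mul_zero, mul_one, zero_smul, one_smul, add_zero, zero_add,
      Matrix.mul_fin_two, Matrix.of_add_of, Matrix.add_cons, Matrix.head_cons, Matrix.tail_cons,
      Matrix.empty_add_empty, zero_mul, Algebra.algebraMap_eq_smul_one, Matrix.one_fin_two] <;>
    congr! 1 <;> try simp
  all_goals try field_simp
  all_goals try ring_nf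
  all_goals first
    | simp only [and_self]
    | (ext a b; fin_cases a <;> fin_cases b <;> rfl)

/-- The action of `Cl_q(sl₂)` on the spin module `S_±` with basis `s₁, s₋₁`. -/
def spin (t : 𝕜) (ht : t ^ 2 = c * (p.q ^ 2 + 1) / p.q) (ε : ℤˣ) :
    Cl p c →ₐ[𝕜] Module.End 𝕜 (Fin 2 → 𝕜) :=
  (Matrix.toLinAlgEquiv' : Matrix (Fin 2) (Fin 2) 𝕜 ≃ₐ[𝕜] _).toAlgHom.comp
    (lift p c (spinMat p t ε) (spinMat_rel p c t ht ε))

end Cl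

/-! ### Weight modules, Verma modules and finite-dimensional modules -/

/-- A `U_q(sl₂)`-module `V` with a basis `w_i` of weight vectors: `K w_i = q ^ (wt i) w_i`. -/
structure WtModule {𝕜 : Type u} [Field 𝕜] (p : QParam 𝕜) where
  V : Type u
  [addCommGroup : AddCommGroup V]
  [module : Module 𝕜 V]
  rep : Uq p →ₐ[𝕜] Module.End 𝕜 V
  ι : Type
  w : Module.Basis ι 𝕜 V
  wt : ι → ℂ
  rep_K : ∀ i, rep (Uq.gen p .K) (w i) = p.pow (wt i) • w i

attribute [instance] WtModule.addCommGroup WtModule.module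

namespace QParam

theorem pow_sub (a b : ℂ) : p.pow (a - b) = p.pow a * (p.pow b)⁻¹ := by
  rw [sub_eq_add_neg, p.pow_add, p.pow_neg]

theorem pow_two_mul (a : ℂ) : p.pow (2 * a) = p.pow a ^ 2 := by
  rw [two_mul, p.pow_add, sq]

theorem pow_two : p.pow 2 = p.q ^ 2 := by
  rw [q, ← p.pow_two_mul, mul_one]

theorem qnum_rel (a m : ℂ) :
    p.qnum (a - (m + 1) + 1) * p.qnum (m + 1) - p.qnum m * p.qnum (a - m + 1) =
      (p.q - p.q⁻¹)⁻¹ * (p.pow (a - 2 * m) - p.pow (-(a - 2 * m))) := by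
  have h1 := p.pow_ne_zero a
  have h2 := p.pow_ne_zero m
  have h3 := p.q_ne_zero
  have h4 := p.q_sq_sub_one
  have hqq : p.q - p.q⁻¹ = (p.q ^ 2 - 1) / p.q := by field_simp
  have h5 : p.pow 1 = p.q := rfl
  simp only [qnum, p.pow_neg, p.pow_add, p.pow_sub, p.pow_two_mul, hqq, h5]
  field_simp
  ring

theorem pow_shift (a m : ℂ) : p.pow (a - 2 * m) = p.pow 2 * p.pow (a - 2 * (m + 1)) := by
  rw [← p.pow_add]
  congr 1
  ring

theorem pow_shift_neg (a m : ℂ) : p.pow (a - 2 * (m + 1)) = p.pow (-2) * p.pow (a - 2 * m) := by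
  rw [← p.pow_add]
  congr 1
  ring

theorem qnum_zero : p.qnum 0 = 0 := by simp [qnum]

end QParam

/-- The action of `E` on the Verma module: `E w_m = [λ - m + 1] w_{m-1}`. -/
def vermaE (lam : ℂ) : Module.End 𝕜 (ℕ →₀ 𝕜) :=
  Finsupp.linearCombination 𝕜 fun m : ℕ =>
    if m = 0 then 0 else p.qnum (lam - m + 1) • Finsupp.single (m - 1) 1

/-- The action of `F` on the Verma module: `F w_m = [m + 1] w_{m+1}`. -/
def vermaF : Module.End 𝕜 (ℕ →₀ 𝕜) :=
  Finsupp.linearCombination 𝕜 fun m : ℕ => p.qnum (m + 1) • Finsupp.single (m + 1) 1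

/-- The action of `K` on the Verma module: `K w_m = q ^ (λ - 2 m) w_m`. -/
def vermaK (lam : ℂ) : Module.End 𝕜 (ℕ →₀ 𝕜) :=
  Finsupp.linearCombination 𝕜 fun m : ℕ => p.pow (lam - 2 * m) • Finsupp.single m 1

/-- The action of `K⁻¹` on the Verma module. -/
def vermaKinv (lam : ℂ) : Module.End 𝕜 (ℕ →₀ 𝕜) :=
  Finsupp.linearCombination 𝕜 fun m : ℕ => p.pow (-(lam - 2 * m)) • Finsupp.single m 1

theorem vermaE_zero (lam : ℂ) : vermaE p lam (Finsupp.single 0 1) = 0 := by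
  simp [vermaE]

theorem vermaE_succ (lam : ℂ) (m : ℕ) : vermaE p lam (Finsupp.single (m + 1) 1) =
    p.qnum (lam - (m + 1) + 1) • Finsupp.single m 1 := by
  rw [vermaE, Finsupp.linearCombination_single, one_smul, if_neg (Nat.succ_ne_zero m),
    Nat.add_sub_cancel, Nat.cast_succ]

theorem vermaF_single (m : ℕ) : vermaF p (Finsupp.single m 1) =
    p.qnum (m + 1) • Finsupp.single (m + 1) 1 := by
  rw [vermaF, Finsupp.linearCombination_single, one_smul]

theorem vermaK_single (lam : ℂ) (m : ℕ) : vermaK p lam (Finsupp.single m 1) =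
    p.pow (lam - 2 * m) • Finsupp.single m 1 := by
  rw [vermaK, Finsupp.linearCombination_single, one_smul]

theorem vermaKinv_single (lam : ℂ) (m : ℕ) : vermaKinv p lam (Finsupp.single m 1) =
    p.pow (-(lam - 2 * m)) • Finsupp.single m 1 := by
  rw [vermaKinv, Finsupp.linearCombination_single, one_smul]

theorem end_ext {ι : Type*} {f g : Module.End 𝕜 (ι →₀ 𝕜)}
    (h : ∀ i, f (Finsupp.single i 1) = g (Finsupp.single i 1)) : f = g :=
  Finsupp.lhom_ext' fun i => LinearMap.ext_ring (h i)

/-- The action of `U_q(sl₂)` on the Verma module `M_{λπ}`. -/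
def vermaRep (lam : ℂ) : Uq p →ₐ[𝕜] Module.End 𝕜 (ℕ →₀ 𝕜) :=
  Uq.rep p (vermaE p lam) (vermaF p) (vermaK p lam) (vermaKinv p lam)
  (end_ext fun m => by
    rcases m with _ | m
    · simp only [Module.End.mul_apply, LinearMap.smul_apply, vermaE_zero, vermaK_single,
        map_zero, map_smul, smul_zero]
    · simp only [Module.End.mul_apply, LinearMap.smul_apply, vermaE_succ, vermaK_single,
        map_smul, smul_smul, ← p.pow_two]
      push_cast
      rw [p.pow_shift]
      congr 1
      ring)
  (end_ext fun m => by
    simp only [Module.End.mul_apply, LinearMap.smul_apply, vermaF_single, vermaK_single,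
      map_smul, smul_smul, ← p.pow_two, ← p.pow_neg]
    push_cast
    rw [p.pow_shift_neg]
    congr 1
    ring)
  (end_ext fun m => by
    simp only [Module.End.mul_apply, vermaK_single, vermaKinv_single, map_smul, smul_smul,
      Module.End.one_apply, mul_comm (p.pow (-_)), p.pow_mul_neg, one_smul])
  (end_ext fun m => by
    simp only [Module.End.mul_apply, vermaK_single, vermaKinv_single, map_smul, smul_smul,
      Module.End.one_apply, p.pow_mul_neg, one_smul])
  (end_ext fun m => by
    have h := p.qnum_rel lam m
    rcases m with _ | m
    · simp only [Nat.cast_zero, p.qnum_zero, zero_mul, sub_zero] at h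
      simp only [LinearMap.sub_apply, Module.End.mul_apply, LinearMap.smul_apply, vermaE_zero,
        vermaE_succ, vermaF_single, vermaK_single, vermaKinv_single, map_smul, smul_smul,
        map_zero, sub_zero, ← sub_smul, Nat.cast_zero]
      rw [← h, mul_comm]
    · simp only [LinearMap.sub_apply, Module.End.mul_apply, LinearMap.smul_apply,
        vermaE_succ, vermaF_single, vermaK_single, vermaKinv_single, map_smul, smul_smul,
        ← sub_smul]
      rw [← h]
      push_cast
      ring_nf)

theorem vermaRep_gen (lam : ℂ) (g : UqGen) : vermaRep p lam (Uq.gen p g) = (match g with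
    | .E => vermaE p lam
    | .F => vermaF p
    | .K => vermaK p lam
    | .Kinv => vermaKinv p lam) := Uq.rep_gen ..

/-- The Verma module `M_{λπ}`, with basis `w_m` of weight `λ - 2 m` for `m : ℕ`. -/
def verma (lam : ℂ) : WtModule p where
  V := ℕ →₀ 𝕜
  ι := ℕ
  w := Finsupp.basisSingleOne
  wt m := lam - 2 * m
  rep := vermaRep p lam
  rep_K m := by
    rw [vermaRep_gen, Finsupp.coe_basisSingleOne]
    exact vermaK_single p lam m

/-- The action of `E` on `V_{kπ}`: `E w_m = [k - m + 1] w_{m-1}`. -/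
def finE (k : ℕ) : Module.End 𝕜 (Fin (k + 1) →₀ 𝕜) :=
  Finsupp.linearCombination 𝕜 fun m : Fin (k + 1) =>
    if m = 0 then 0 else p.qnum (k - (m : ℕ) + 1) •
      Finsupp.single ⟨(m : ℕ) - 1, (Nat.sub_le _ _).trans_lt m.2⟩ 1

/-- The action of `F` on `V_{kπ}`: `F w_m = [m + 1] w_{m+1}`, where `w_{k+1} = 0`. -/
def finF (k : ℕ) : Module.End 𝕜 (Fin (k + 1) →₀ 𝕜) :=
  Finsupp.linearCombination 𝕜 fun m : Fin (k + 1) =>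
    if h : (m : ℕ) + 1 < k + 1 then p.qnum ((m : ℕ) + 1) • Finsupp.single ⟨(m : ℕ) + 1, h⟩ 1 else 0

/-- The action of `K` on `V_{kπ}`: `K w_m = q ^ (k - 2 m) w_m`. -/
def finK (k : ℕ) : Module.End 𝕜 (Fin (k + 1) →₀ 𝕜) :=
  Finsupp.linearCombination 𝕜 fun m : Fin (k + 1) =>
    p.pow (k - 2 * (m : ℕ)) • Finsupp.single m 1

/-- The action of `K⁻¹` on `V_{kπ}`. -/
def finKinv (k : ℕ) : Module.End 𝕜 (Fin (k + 1) →₀ 𝕜) :=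
  Finsupp.linearCombination 𝕜 fun m : Fin (k + 1) =>
    p.pow (-(k - 2 * (m : ℕ))) • Finsupp.single m 1

theorem finE_zero (k : ℕ) (h : 0 < k + 1) : finE p k (Finsupp.single ⟨0, h⟩ 1) = 0 := by
  rw [finE, Finsupp.linearCombination_single, one_smul]
  exact if_pos rfl

theorem finE_succ (k m : ℕ) (h : m + 1 < k + 1) : finE p k (Finsupp.single ⟨m + 1, h⟩ 1) =
    p.qnum (k - (m + 1) + 1) • Finsupp.single ⟨m, (Nat.lt_succ_self m).trans h⟩ 1 := by
  rw [finE, Finsupp.linearCombination_single, one_smul, if_neg (by simp [Fin.ext_iff])]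
  simp only [Nat.cast_succ, Nat.add_sub_cancel]

theorem finF_lt (k m : ℕ) (hm : m < k + 1) (h : m + 1 < k + 1) :
    finF p k (Finsupp.single ⟨m, hm⟩ 1) = p.qnum (m + 1) • Finsupp.single ⟨m + 1, h⟩ 1 := by
  rw [finF, Finsupp.linearCombination_single, one_smul, dif_pos h]

theorem finF_last (k m : ℕ) (hm : m < k + 1) (h : ¬ m + 1 < k + 1) :
    finF p k (Finsupp.single ⟨m, hm⟩ 1) = 0 := by
  rw [finF, Finsupp.linearCombination_single, one_smul, dif_neg h]

theorem finK_single (k m : ℕ) (hm : m < k + 1) : finK p k (Finsupp.single ⟨m, hm⟩ 1) =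
    p.pow (k - 2 * m) • Finsupp.single ⟨m, hm⟩ 1 := by
  rw [finK, Finsupp.linearCombination_single, one_smul]

theorem finKinv_single (k m : ℕ) (hm : m < k + 1) : finKinv p k (Finsupp.single ⟨m, hm⟩ 1) =
    p.pow (-(k - 2 * m)) • Finsupp.single ⟨m, hm⟩ 1 := by
  rw [finKinv, Finsupp.linearCombination_single, one_smul]

/-- The action of `U_q(sl₂)` on `V_{kπ}`. -/
def finRep (k : ℕ) : Uq p →ₐ[𝕜] Module.End 𝕜 (Fin (k + 1) →₀ 𝕜) :=
  Uq.rep p (finE p k) (finF p k) (finK p k) (finKinv p k)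
  (end_ext fun ⟨m, hm⟩ => by
    rcases m with _ | m
    · simp only [Module.End.mul_apply, LinearMap.smul_apply, finE_zero, finK_single,
        map_zero, map_smul, smul_zero]
    · simp only [Module.End.mul_apply, LinearMap.smul_apply, finE_succ, finK_single,
        map_smul, smul_smul, ← p.pow_two]
      push_cast
      rw [p.pow_shift]
      congr 1
      ring)
  (end_ext fun ⟨m, hm⟩ => by
    by_cases h : m + 1 < k + 1
    · simp only [Module.End.mul_apply, LinearMap.smul_apply, finF_lt p k m hm h, finK_single,
        map_smul, smul_smul, ← p.pow_two, ← p.pow_neg]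
      push_cast
      rw [p.pow_shift_neg]
      congr 1
      ring
    · simp only [Module.End.mul_apply, LinearMap.smul_apply, finF_last p k m hm h, finK_single,
        map_smul, map_zero, smul_zero])
  (end_ext fun ⟨m, hm⟩ => by
    simp only [Module.End.mul_apply, finK_single, finKinv_single, map_smul, smul_smul,
      Module.End.one_apply, mul_comm (p.pow (-_)), p.pow_mul_neg, one_smul])
  (end_ext fun ⟨m, hm⟩ => by
    simp only [Module.End.mul_apply, finK_single, finKinv_single, map_smul, smul_smul,
      Module.End.one_apply, p.pow_mul_neg, one_smul])
  (end_ext fun ⟨m, hm⟩ => by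
    have h := p.qnum_rel k m
    have hEF : finE p k (finF p k (Finsupp.single ⟨m, hm⟩ 1)) =
        (p.qnum (k - (m + 1) + 1) * p.qnum (m + 1)) • Finsupp.single ⟨m, hm⟩ 1 := by
      by_cases hk : m + 1 < k + 1
      · rw [finF_lt p k m hm hk, map_smul, finE_succ, smul_smul, mul_comm]
      · have : m = k := by omega
        subst this
        rw [finF_last p m m hm hk, map_zero]
        simp [p.qnum_zero]
    have hFE : finF p k (finE p k (Finsupp.single ⟨m, hm⟩ 1)) =
        (p.qnum m * p.qnum (k - m + 1)) • Finsupp.single ⟨m, hm⟩ 1 := by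
      rcases m with _ | m
      · rw [finE_zero, map_zero, Nat.cast_zero, p.qnum_zero, zero_mul, zero_smul]
      · rw [finE_succ, map_smul, finF_lt p k m _ hm, smul_smul, mul_comm]
        push_cast
        rfl
    rw [LinearMap.sub_apply, Module.End.mul_apply, Module.End.mul_apply, hEF, hFE,
      LinearMap.smul_apply, LinearMap.sub_apply, finK_single, finKinv_single, ← sub_smul,
      ← sub_smul, smul_smul, h])

theorem finRep_gen (k : ℕ) (g : UqGen) : finRep p k (Uq.gen p g) = (match g with
    | .E => finE p k
    | .F => finF p k
    | .K => finK p k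
    | .Kinv => finKinv p k) := Uq.rep_gen ..

/-- The simple module `V_{kπ}`, with basis `w_m` of weight `k - 2 m` for `0 ≤ m ≤ k`. -/
def finMod (k : ℕ) : WtModule p where
  V := Fin (k + 1) →₀ 𝕜
  ι := Fin (k + 1)
  w := Finsupp.basisSingleOne
  wt m := k - 2 * (m : ℕ)
  rep := finRep p k
  rep_K := fun ⟨m, hm⟩ => by
    rw [finRep_gen, Finsupp.coe_basisSingleOne]
    exact finK_single p k m hm

/-! ### The `R`-matrix braiding, the Dirac operator and Dirac cohomology -/

/-- The space `ker D / (im D ∩ ker D)` of a linear endomorphism `D`. -/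
abbrev Cohomology {V : Type*} [AddCommGroup V] [Module 𝕜 V] (D : Module.End 𝕜 V) : Type _ :=
  LinearMap.ker D ⧸ (LinearMap.range D ⊓ LinearMap.ker D).submoduleOf (LinearMap.ker D)

/-- The class in `ker D / (im D ∩ ker D)` of an element of `ker D`. -/
def cohomologyClass {V : Type*} [AddCommGroup V] [Module 𝕜 V] (D : Module.End 𝕜 V) (x : V)
    (hx : D x = 0) : Cohomology D :=
  Submodule.Quotient.mk ⟨x, LinearMap.mem_ker.2 hx⟩

section Dirac

variable (M : WtModule p)

/-- The action of
`∑ m, q ^ (m (m - 1) / 2) (q - q⁻¹) ^ m / [m]_q! • E ^ m ⊗ F ^ m` on `Cl_q(sl₂) ⊗ M`. The sum is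
finite, because `E` acts nilpotently on `Cl_q(sl₂)`. -/
def unipotentR : Cl p c ⊗[𝕜] M.V →ₗ[𝕜] Cl p c ⊗[𝕜] M.V :=
  ∑ᶠ m : ℕ, (p.q ^ (m * (m - 1) / 2) * (p.q - p.q⁻¹) ^ m / p.qfact m) •
    TensorProduct.map (Cl.rep p c (Uq.gen p .E) ^ m) (M.rep (Uq.gen p .F) ^ m)

/-- The action of `q ^ (H ⊗ H / 2)` on `Cl_q(sl₂) ⊗ M`, that is, `x ⊗ w ↦ q ^ (a b / 2) x ⊗ w` for
`x` of weight `a` and `w` of weight `b`. -/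
def diagonalR : Cl p c ⊗[𝕜] M.V →ₗ[𝕜] Cl p c ⊗[𝕜] M.V :=
  TensorProduct.lift (LinearMap.flip (M.w.constr 𝕜 fun i : M.ι =>
    (TensorProduct.mk 𝕜 (Cl p c) M.V).flip (M.w i) ∘ₗ
      (Cl.torus p c (p.powUnit (M.wt i))).toLinearMap))

/-- The braiding `σ_R : Cl_q(sl₂) ⊗ M → M ⊗ Cl_q(sl₂)`, the flip composed with the action of the
universal `R`-matrix. -/
def braiding : Cl p c ⊗[𝕜] M.V →ₗ[𝕜] M.V ⊗[𝕜] Cl p c :=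
  (TensorProduct.comm 𝕜 (Cl p c) M.V).toLinearMap ∘ₗ diagonalR p c M ∘ₗ unipotentR p c M

/-- The underlying vector space of the noncommutative Weil algebra `U_q(sl₂) ⊗_R Cl_q(sl₂)`. -/
abbrev Weil : Type _ := Uq p ⊗[𝕜] Cl p c

/-- The cubic Dirac element `D_q`. -/
def diracElement : Weil p c :=
  c⁻¹ • (Uq.X p ⊗ₜ Cl.v p c 2 + (p.q / (1 + p.q ^ 2)) • (Uq.Z p ⊗ₜ Cl.v p c 1) +
      (p.q ^ 2)⁻¹ • (Uq.Y p ⊗ₜ Cl.v p c 0)) -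
    ((p.q ^ 2 - 1) ^ 2 / (2 * p.q * (p.q ^ 2 + 1) * c ^ 2)) •
      (Uq.C p ⊗ₜ (Cl.v p c 0 * Cl.v p c 1 * Cl.v p c 2 + c • Cl.v p c 1))

variable (t : 𝕜) (ht : t ^ 2 = c * (p.q ^ 2 + 1) / p.q) (ε : ℤˣ)

/-- The space `M ⊗ S_±`. -/
abbrev SpinTensor : Type _ := M.V ⊗[𝕜] (Fin 2 → 𝕜)

/-- The braided action `(ρ_M ⊗ ρ_S) ∘ (id ⊗ σ_R ⊗ id)` of the Weil algebra on `M ⊗ S_±`. -/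
def braidedAction : Weil p c ⊗[𝕜] SpinTensor p M →ₗ[𝕜] SpinTensor p M :=
  TensorProduct.map (TensorProduct.lift M.rep.toLinearMap)
      (TensorProduct.lift (Cl.spin p c t ht ε).toLinearMap) ∘ₗ
    (TensorProduct.assoc 𝕜 (Uq p) M.V (Cl p c ⊗[𝕜] (Fin 2 → 𝕜))).symm.toLinearMap ∘ₗ
    LinearMap.lTensor (Uq p)
      ((TensorProduct.assoc 𝕜 M.V (Cl p c) (Fin 2 → 𝕜)).toLinearMap ∘ₗ
        LinearMap.rTensor (Fin 2 → 𝕜) (braiding p c M) ∘ₗ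
        (TensorProduct.assoc 𝕜 (Cl p c) M.V (Fin 2 → 𝕜)).symm.toLinearMap) ∘ₗ
    (TensorProduct.assoc 𝕜 (Uq p) (Cl p c) (SpinTensor p M)).toLinearMap

/-- The operator by which `D_q` acts on `M ⊗ S_±`. -/
def dirac : Module.End 𝕜 (SpinTensor p M) :=
  TensorProduct.curry (braidedAction p c M t ht ε) (diracElement p c)

/-- The Dirac cohomology `H_D(M)`, computed with the spin module `S_±`. -/
abbrev DiracCohomology : Type _ := Cohomology (dirac p c M t ht ε)

/-- The vector `w_m ⊗ s₁` of `M_{λπ} ⊗ S_±`. -/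
def vermaUp (lam : ℂ) (m : ℕ) : SpinTensor p (verma p lam) :=
  (verma p lam).w (m : ℕ) ⊗ₜ Pi.single 0 1

/-- The vector `w_m ⊗ s₋₁` of `M_{λπ} ⊗ S_±`. -/
def vermaDown (lam : ℂ) (m : ℕ) : SpinTensor p (verma p lam) :=
  (verma p lam).w (m : ℕ) ⊗ₜ Pi.single 1 1

/-- The subspace of `M_{λπ} ⊗ S_±` spanned by `w_m ⊗ s₁` and `w_{m-1} ⊗ s₋₁`, where `m ≥ 1`. -/
def vermaBlock (lam : ℂ) (m : ℕ) : Submodule 𝕜 (SpinTensor p (verma p lam)) :=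
  Submodule.span 𝕜 {vermaUp p lam m, vermaDown p lam (m - 1)}

end Dirac

end QDirac

end

open QDirac

open scoped TensorProduct LaurentSeries

namespace QDirac

universe u

variable {𝕜 : Type u} [Field 𝕜] (p : QParam 𝕜) (c : 𝕜)

namespace Cl

theorem r00_mul (x : Cl p c) : v p c 0 * (v p c 0 * x) = 0 := by
  rw [← mul_assoc, r00, zero_mul]

theorem r10_mul (x : Cl p c) :
    v p c 1 * (v p c 0 * x) = -((p.q ^ 2)⁻¹ • (v p c 0 * (v p c 1 * x))) := by
  rw [← mul_assoc, r10, neg_mul, smul_mul_assoc, mul_assoc]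

theorem r21_mul (x : Cl p c) :
    v p c 2 * (v p c 1 * x) = -((p.q ^ 2)⁻¹ • (v p c 1 * (v p c 2 * x))) := by
  rw [← mul_assoc, r21, neg_mul, smul_mul_assoc, mul_assoc]

theorem r11_mul (x : Cl p c) : v p c 1 * (v p c 1 * x) =
    ((1 - p.q ^ 4) / p.q ^ 3) • (v p c 0 * (v p c 2 * x)) + ((p.q ^ 2 + 1) / p.q * c) • x := by
  rw [← mul_assoc, r11, add_mul, smul_mul_assoc, mul_assoc, smul_mul_assoc, one_mul]

theorem r20_mul (x : Cl p c) : v p c 2 * (v p c 0 * x) =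
    -(v p c 0 * (v p c 2 * x)) + ((p.q ^ 2 + 1) / p.q ^ 2 * c) • x := by
  rw [← mul_assoc, r20, add_mul, neg_mul, mul_assoc, smul_mul_assoc, one_mul]

/-- The ordered monomials in the generators. -/
def monomial : Fin 8 → Cl p c :=
  ![1, v p c 0, v p c 1, v p c 2, v p c 0 * v p c 1, v p c 0 * v p c 2, v p c 1 * v p c 2,
    v p c 0 * (v p c 1 * v p c 2)]

theorem v_mul_monomial_mem (i : Fin 3) (a : Fin 8) :
    v p c i * monomial p c a ∈ Submodule.span 𝕜 (Set.range (monomial p c)) := by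
  have h0 := Submodule.subset_span (R := 𝕜) (Set.mem_range_self (f := monomial p c) 0)
  have h1 := Submodule.subset_span (R := 𝕜) (Set.mem_range_self (f := monomial p c) 1)
  have h2 := Submodule.subset_span (R := 𝕜) (Set.mem_range_self (f := monomial p c) 2)
  have h3 := Submodule.subset_span (R := 𝕜) (Set.mem_range_self (f := monomial p c) 3)
  have h4 := Submodule.subset_span (R := 𝕜) (Set.mem_range_self (f := monomial p c) 4)
  have h5 := Submodule.subset_span (R := 𝕜) (Set.mem_range_self (f := monomial p c) 5)
  have h6 := Submodule.subset_span (R := 𝕜) (Set.mem_range_self (f := monomial p c) 6)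
  have h7 := Submodule.subset_span (R := 𝕜) (Set.mem_range_self (f := monomial p c) 7)
  generalize Submodule.span 𝕜 (Set.range (monomial p c)) = S at *
  simp only [monomial, Matrix.cons_val] at h0 h1 h2 h3 h4 h5 h6 h7
  fin_cases i <;> fin_cases a <;>
    simp only [monomial, Fin.zero_eta, Fin.mk_one, Fin.reduceFinMk, Matrix.cons_val, mul_one,
      r00, r10, r11, r20, r21, r22, r00_mul, r10_mul, r11_mul, r20_mul, r21_mul,
      mul_add, mul_neg, mul_smul_comm, mul_zero, neg_zero, smul_zero, zero_add] <;>
    first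
    | assumption
    | exact S.zero_mem
    | (repeat' first | assumption | exact S.zero_mem | apply S.add_mem | apply S.neg_mem |
        apply S.smul_mem)

theorem span_monomial : Submodule.span 𝕜 (Set.range (monomial p c)) = ⊤ := by
  rw [eq_top_iff]
  intro x _
  have key : ∀ y ∈ Submodule.span 𝕜 (Set.range (monomial p c)),
      x * y ∈ Submodule.span 𝕜 (Set.range (monomial p c)) := by
    induction x using Cl.induction with
    | scalar r =>
      intro y hy
      rw [← Algebra.smul_def]
      exact Submodule.smul_mem _ _ hy
    | gen i =>
      intro y hy
      induction hy using Submodule.span_induction with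
      | mem y hy =>
        obtain ⟨a, rfl⟩ := hy
        exact v_mul_monomial_mem p c i a
      | zero => simp
      | add a b _ _ ha hb => rw [mul_add]; exact Submodule.add_mem _ ha hb
      | smul r a _ ha => rw [mul_smul_comm]; exact Submodule.smul_mem _ _ ha
    | mul x y hx hy =>
      intro z hz
      rw [mul_assoc]
      exact hx trivial _ (hy trivial z hz)
    | add x y hx hy =>
      intro z hz
      rw [add_mul]
      exact Submodule.add_mem _ (hx trivial z hz) (hy trivial z hz)
  simpa using key 1 (Submodule.subset_span ⟨0, rfl⟩)

theorem actE_one : actE p c 1 = 0 := by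
  simpa using actE_algebraMap p c 1

theorem actE_cube_monomial (a : Fin 8) :
    actE p c (actE p c (actE p c (monomial p c a))) = 0 := by
  fin_cases a <;>
    simp [monomial, actE_one, actE_mul, actE_v, actK_v, adE, wt, mul_add, smul_smul, r00, r11,
      r00_mul]

theorem actE_pow_three : actE p c ^ 3 = 0 := by
  refine LinearMap.ext_on_range (span_monomial p c) fun a => ?_
  simpa [pow_succ] using actE_cube_monomial p c a

/-- The degree-three invariant `v₂ v₀ v₋₂ + c v₀` of the Clifford algebra. -/
def cubic : Cl p c := v p c 0 * v p c 1 * v p c 2 + c • v p c 1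

theorem actE_cubic : actE p c (cubic p c) = 0 := by
  have hq := p.q_ne_zero
  simp [cubic, actE_mul, actE_v, actK_v, adE, wt, mul_add, mul_assoc,
    smul_smul, r11, r00_mul]
  match_scalars
  field_simp
  ring

theorem torus_cubic (u : 𝕜ˣ) : torus p c u (cubic p c) = cubic p c := by
  simp [cubic, torus_v, wt, smul_smul]

theorem rep_E : rep p c (Uq.gen p .E) = actE p c := Uq.rep_gen ..

end Cl

theorem QParam.qfact_zero : p.qfact 0 = 1 := Finset.prod_range_zero _

theorem QParam.qfact_one : p.qfact 1 = 1 := by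
  rw [QParam.qfact, Finset.prod_range_one, Nat.cast_zero, zero_add, QParam.qnum, p.pow_neg]
  exact div_self p.q_sub_inv

theorem QParam.qnum_two : p.qnum 2 = p.q + p.q⁻¹ := by
  have := p.q_sub_inv
  rw [QParam.qnum, p.pow_neg, p.pow_two, div_eq_iff this]
  ring

theorem QParam.qfact_two : p.qfact 2 = p.q + p.q⁻¹ := by
  rw [QParam.qfact, Finset.prod_range_succ, ← QParam.qfact, p.qfact_one, one_mul, Nat.cast_one,
    one_add_one_eq_two, p.qnum_two]

section Weil

variable (M : WtModule p)

theorem unipotentR_tmul (x : Cl p c) (y : M.V) :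
    unipotentR p c M (x ⊗ₜ y) = x ⊗ₜ y +
      (p.q - p.q⁻¹) • (Cl.actE p c x ⊗ₜ M.rep (Uq.gen p .F) y) +
      (p.q * (p.q - p.q⁻¹) ^ 2 / (p.q + p.q⁻¹)) •
        (Cl.actE p c (Cl.actE p c x) ⊗ₜ M.rep (Uq.gen p .F) (M.rep (Uq.gen p .F) y)) := by
  rw [unipotentR, finsum_eq_sum_of_support_subset (s := Finset.range 3)]
  · simp [Finset.sum_range_succ, Cl.rep_E, p.qfact_one, p.qfact_two, p.qfact_zero, pow_two]
  · intro m hm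
    rw [Function.mem_support] at hm
    by_contra h
    have h3 : 3 ≤ m := by simpa using h
    apply hm
    rw [Cl.rep_E, pow_eq_zero_of_le h3 (Cl.actE_pow_three p c), TensorProduct.map_zero_left,
      smul_zero]

theorem WtModule.rep_Kinv (i : M.ι) :
    M.rep (Uq.gen p .Kinv) (M.w i) = p.pow (-M.wt i) • M.w i := by
  have h : Uq.gen p .Kinv * Uq.gen p .K = 1 := by
    have := RingQuot.mkAlgHom_rel 𝕜 (UqRel.KinvK (p := p))
    rw [map_mul, map_one] at this
    exact this
  have h' := LinearMap.congr_fun (congrArg M.rep h) (M.w i)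
  simp only [map_mul, Module.End.mul_apply, M.rep_K, map_smul, map_one, Module.End.one_apply] at h'
  rw [p.pow_neg, eq_inv_smul_iff₀ (p.pow_ne_zero _), h']

/-- The diagonal part of the `R`-matrix on a vector of weight `2 n`, given an operator `T` acting
as `K ^ n`. -/
theorem diagonalR_tmul (x : Cl p c) (n : ℤ) (T : Module.End 𝕜 M.V)
    (hx : ∀ u, Cl.torus p c u x = ((u ^ n : 𝕜ˣ) : 𝕜) • x)
    (hT : ∀ i, T (M.w i) = p.pow (M.wt i) ^ n • M.w i) (y : M.V) :
    diagonalR p c M (x ⊗ₜ y) = x ⊗ₜ T y := by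
  have : (diagonalR p c M) ∘ₗ TensorProduct.mk 𝕜 (Cl p c) M.V x =
      TensorProduct.mk 𝕜 (Cl p c) M.V x ∘ₗ T := by
    refine M.w.ext fun i => ?_
    simp [diagonalR, hx, hT, QParam.powUnit]
  exact LinearMap.congr_fun this y

theorem diagonalR_v_zero (y : M.V) :
    diagonalR p c M (Cl.v p c 0 ⊗ₜ y) = Cl.v p c 0 ⊗ₜ M.rep (Uq.gen p .K) y :=
  diagonalR_tmul p c M _ 1 _ (fun u => Cl.torus_v ..) (fun i => by simp [M.rep_K]) y

theorem diagonalR_v_one (y : M.V) :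
    diagonalR p c M (Cl.v p c 1 ⊗ₜ y) = Cl.v p c 1 ⊗ₜ y :=
  diagonalR_tmul p c M _ 0 1 (fun u => Cl.torus_v ..) (fun i => by simp) y

theorem diagonalR_v_two (y : M.V) :
    diagonalR p c M (Cl.v p c 2 ⊗ₜ y) = Cl.v p c 2 ⊗ₜ M.rep (Uq.gen p .Kinv) y :=
  diagonalR_tmul p c M _ (-1) _ (fun u => Cl.torus_v ..)
    (fun i => by simp [WtModule.rep_Kinv, p.pow_neg]) y

theorem braiding_v_zero (y : M.V) :
    braiding p c M (Cl.v p c 0 ⊗ₜ y) = M.rep (Uq.gen p .K) y ⊗ₜ Cl.v p c 0 := by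
  simp [braiding, unipotentR_tmul, Cl.actE_v, Cl.adE, diagonalR_v_zero]

theorem braiding_v_one (y : M.V) :
    braiding p c M (Cl.v p c 1 ⊗ₜ y) = y ⊗ₜ Cl.v p c 1 -
      ((p.q - p.q⁻¹) * (p.q + p.q⁻¹)) •
        (M.rep (Uq.gen p .K) (M.rep (Uq.gen p .F) y) ⊗ₜ Cl.v p c 0) := by
  simp only [braiding, LinearMap.comp_apply, unipotentR_tmul, Cl.actE_v, Cl.adE, Matrix.cons_val,
    ← TensorProduct.smul_tmul', map_smul, map_add, smul_zero, TensorProduct.zero_tmul, map_zero,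
    diagonalR_v_zero, diagonalR_v_one, LinearEquiv.coe_coe, TensorProduct.comm_tmul]
  module

theorem braiding_v_two (y : M.V) :
    braiding p c M (Cl.v p c 2 ⊗ₜ y) = M.rep (Uq.gen p .Kinv) y ⊗ₜ Cl.v p c 2 +
      (p.q - p.q⁻¹) • (M.rep (Uq.gen p .F) y ⊗ₜ Cl.v p c 1) -
      (p.q * (p.q - p.q⁻¹) ^ 2) •
        (M.rep (Uq.gen p .K) (M.rep (Uq.gen p .F) (M.rep (Uq.gen p .F) y)) ⊗ₜ Cl.v p c 0) := by
  have h1 := p.q_ne_zero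
  have h2 := p.q_sq_add_one
  simp only [braiding, LinearMap.comp_apply, unipotentR_tmul, Cl.actE_v, Cl.adE, Matrix.cons_val,
    ← TensorProduct.smul_tmul', map_smul, map_add, diagonalR_v_zero, diagonalR_v_one, diagonalR_v_two, LinearEquiv.coe_coe,
    TensorProduct.comm_tmul, smul_smul]
  match_scalars <;> field_simp

theorem braiding_cubic (y : M.V) :
    braiding p c M (Cl.cubic p c ⊗ₜ y) = y ⊗ₜ Cl.cubic p c := by
  simp [braiding, unipotentR_tmul, Cl.actE_cubic,
    diagonalR_tmul p c M (Cl.cubic p c) 0 1 (by simp [Cl.torus_cubic]) (by simp)]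

variable (t : 𝕜) (ht : t ^ 2 = c * (p.q ^ 2 + 1) / p.q) (ε : ℤˣ)

/-- The action `ρ_M(u) ⊗ ρ_S` of the tensors `y ⊗ x` on a vector `s` of the spin module. -/
def spinAction (u : Uq p) (s : Fin 2 → 𝕜) : M.V ⊗[𝕜] Cl p c →ₗ[𝕜] SpinTensor p M :=
  TensorProduct.map (M.rep u) ((Cl.spin p c t ht ε).toLinearMap.flip s)

theorem spinAction_tmul (u : Uq p) (s : Fin 2 → 𝕜) (y : M.V) (x : Cl p c) :
    spinAction p c M t ht ε u s (y ⊗ₜ x) = M.rep u y ⊗ₜ Cl.spin p c t ht ε x s := rfl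

theorem braidedAction_tmul (u : Uq p) (x : Cl p c) (y : M.V) (s : Fin 2 → 𝕜) :
    braidedAction p c M t ht ε ((u ⊗ₜ x) ⊗ₜ (y ⊗ₜ s)) =
      spinAction p c M t ht ε u s (braiding p c M (x ⊗ₜ y)) := by
  simp only [braidedAction, LinearMap.comp_apply, LinearEquiv.coe_coe, TensorProduct.assoc_tmul,
    LinearMap.lTensor_tmul, TensorProduct.assoc_symm_tmul, LinearMap.rTensor_tmul]
  induction braiding p c M (x ⊗ₜ y) with
  | zero => simp
  | tmul a b => rfl
  | add a b ha hb => simp only [TensorProduct.add_tmul, TensorProduct.tmul_add, map_add, ha, hb]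

theorem dirac_tmul (y : M.V) (s : Fin 2 → 𝕜) :
    dirac p c M t ht ε (y ⊗ₜ s) =
      c⁻¹ • (spinAction p c M t ht ε (Uq.X p) s (braiding p c M (Cl.v p c 2 ⊗ₜ y)) +
        (p.q / (1 + p.q ^ 2)) •
          spinAction p c M t ht ε (Uq.Z p) s (braiding p c M (Cl.v p c 1 ⊗ₜ y)) +
        (p.q ^ 2)⁻¹ • spinAction p c M t ht ε (Uq.Y p) s (braiding p c M (Cl.v p c 0 ⊗ₜ y))) -
      ((p.q ^ 2 - 1) ^ 2 / (2 * p.q * (p.q ^ 2 + 1) * c ^ 2)) •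
        spinAction p c M t ht ε (Uq.C p) s (braiding p c M (Cl.cubic p c ⊗ₜ y)) := by
  simp only [← braidedAction_tmul]
  simp only [dirac, diracElement, map_sub, map_add, map_smul, LinearMap.sub_apply,
    LinearMap.add_apply, LinearMap.smul_apply, TensorProduct.curry_apply,
    Cl.cubic]

end Weil

section Spin

variable (t : 𝕜) (ht : t ^ 2 = c * (p.q ^ 2 + 1) / p.q) (ε : ℤˣ)

/-- The vector `s₁` of the spin module. -/
abbrev spinUp : Fin 2 → 𝕜 := Pi.single 0 1

/-- The vector `s₋₁` of the spin module. -/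
abbrev spinDown : Fin 2 → 𝕜 := Pi.single 1 1

theorem spin_v (i : Fin 3) (s : Fin 2 → 𝕜) :
    Cl.spin p c t ht ε (Cl.v p c i) s = Matrix.mulVec (Cl.spinMat p t ε i) s := by
  simp [Cl.spin, Cl.lift_v]

theorem spin_v_zero_up : Cl.spin p c t ht ε (Cl.v p c 0) spinUp = 0 := by
  ext j
  fin_cases j <;> simp [spin_v, Cl.spinMat]

theorem spin_v_one_up : Cl.spin p c t ht ε (Cl.v p c 1) spinUp =
    (-((ε : ℤ) : 𝕜) * (t / p.q ^ 2)) • spinUp := by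
  ext j
  fin_cases j <;> simp [spin_v, Cl.spinMat]

theorem spin_v_two_up : Cl.spin p c t ht ε (Cl.v p c 2) spinUp = (t / p.q) • spinDown := by
  ext j
  fin_cases j <;> simp [spin_v, Cl.spinMat]

theorem spin_v_zero_down : Cl.spin p c t ht ε (Cl.v p c 0) spinDown = t • spinUp := by
  ext j
  fin_cases j <;> simp [spin_v, Cl.spinMat]

theorem spin_v_one_down : Cl.spin p c t ht ε (Cl.v p c 1) spinDown =
    (((ε : ℤ) : 𝕜) * t) • spinDown := by
  ext j
  fin_cases j <;> simp [spin_v, Cl.spinMat]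

theorem spin_v_two_down : Cl.spin p c t ht ε (Cl.v p c 2) spinDown = 0 := by
  ext j
  fin_cases j <;> simp [spin_v, Cl.spinMat]

theorem spin_cubic_up : Cl.spin p c t ht ε (Cl.cubic p c) spinUp =
    (((ε : ℤ) : 𝕜) * t * c) • spinUp := by
  have hq := p.q_ne_zero
  simp only [Cl.cubic, map_add, map_mul, map_smul, LinearMap.add_apply, LinearMap.smul_apply,
    Module.End.mul_apply, spin_v_zero_down, spin_v_one_down, spin_v_one_up,
    spin_v_two_up, smul_smul, ← add_smul]
  congr 1
  field_simp at ht ⊢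
  linear_combination t * ((ε : ℤ) : 𝕜) * ht

theorem spin_cubic_down : Cl.spin p c t ht ε (Cl.cubic p c) spinDown =
    (((ε : ℤ) : 𝕜) * t * c) • spinDown := by
  simp only [Cl.cubic, map_add, map_mul, map_smul, LinearMap.add_apply, LinearMap.smul_apply,
    Module.End.mul_apply, spin_v_one_down, spin_v_two_down, map_zero, zero_add, smul_smul]
  congr 1
  ring

end Spin

section Block

variable (M : WtModule p)

theorem gen_E_mul_K : Uq.gen p .E * Uq.gen p .K = (p.q ^ 2)⁻¹ • (Uq.gen p .K * Uq.gen p .E) := by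
  have h := RingQuot.mkAlgHom_rel 𝕜 (UqRel.KE (p := p))
  rw [map_mul, map_smul, map_mul] at h
  rw [eq_inv_smul_iff₀ (pow_ne_zero 2 p.q_ne_zero)]
  exact h.symm

theorem gen_E_mul_F : Uq.gen p .E * Uq.gen p .F = Uq.gen p .F * Uq.gen p .E +
    (p.q - p.q⁻¹)⁻¹ • (Uq.gen p .K - Uq.gen p .Kinv) := by
  have h := RingQuot.mkAlgHom_rel 𝕜 (UqRel.EF (p := p))
  rw [map_sub, map_smul, map_mul, map_mul, map_sub] at h
  rw [← sub_eq_iff_eq_add']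
  exact h

theorem WtModule.rep_E_K (y : M.V) : M.rep (Uq.gen p .E) (M.rep (Uq.gen p .K) y) =
    (p.q ^ 2)⁻¹ • M.rep (Uq.gen p .K) (M.rep (Uq.gen p .E) y) := by
  simpa using LinearMap.congr_fun (congrArg M.rep (gen_E_mul_K p)) y

theorem WtModule.rep_E_F (y : M.V) : M.rep (Uq.gen p .E) (M.rep (Uq.gen p .F) y) =
    M.rep (Uq.gen p .F) (M.rep (Uq.gen p .E) y) +
      (p.q - p.q⁻¹)⁻¹ • (M.rep (Uq.gen p .K) y - M.rep (Uq.gen p .Kinv) y) := by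
  simpa using LinearMap.congr_fun (congrArg M.rep (gen_E_mul_F p)) y

/-- Two vectors `y = w_m` and `z = w_{m-1}` of a weight string with highest weight `λ`; either of
them may vanish. -/
structure IsLinked (lam m : ℂ) (y z : M.V) : Prop where
  E_apply : M.rep (Uq.gen p .E) y = p.qnum (lam - m + 1) • z
  F_apply : M.rep (Uq.gen p .F) z = p.qnum m • y
  K_left : M.rep (Uq.gen p .K) y = p.pow (lam - 2 * m) • y
  K_right : M.rep (Uq.gen p .K) z = p.pow (lam - 2 * m + 2) • z
  Kinv_left : M.rep (Uq.gen p .Kinv) y = p.pow (-(lam - 2 * m)) • y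
  Kinv_right : M.rep (Uq.gen p .Kinv) z = p.pow (-(lam - 2 * m + 2)) • z

/-- The diagonal entry of the Dirac operator on a linked pair, up to the factor `± t / c`. -/
noncomputable def diagCoeff (lam m : ℂ) : 𝕜 :=
  (2 * p.pow (2 * m - (lam + 1)) - p.pow (lam + 1) - p.pow (-(lam + 1))) / (2 * (p.q - p.q⁻¹))

/-- The entry of the Dirac operator from `y ⊗ s₁` to `z ⊗ s₋₁`, up to the factor `t / c`. -/
noncomputable def lowerCoeff (lam m : ℂ) : 𝕜 :=
  p.q⁻¹ * p.pow (-(lam - 2 * m)) * p.qnum (lam - m + 1)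

theorem diagCoeff_zero (lam : ℂ) : diagCoeff p lam 0 = -(p.qnum (lam + 1) / 2) := by
  have h2 := p.two_ne_zero
  have h3 := p.q_sub_inv
  rw [diagCoeff, QParam.qnum, mul_zero, zero_sub]
  field_simp
  ring

theorem diagCoeff_sq (lam m : ℂ) :
    diagCoeff p lam m ^ 2 + p.qnum m * lowerCoeff p lam m = (p.qnum (lam + 1) / 2) ^ 2 := by
  have h1 := p.pow_ne_zero lam
  have h2 := p.pow_ne_zero m
  have h3 := p.q_ne_zero
  have h4 := p.q_sq_sub_one
  have h5 := p.two_ne_zero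
  have hqq : p.q - p.q⁻¹ = (p.q ^ 2 - 1) / p.q := by field_simp
  have h6 : p.pow 1 = p.q := rfl
  simp only [diagCoeff, lowerCoeff, QParam.qnum, p.pow_neg, p.pow_add, p.pow_sub, p.pow_two_mul,
    hqq, h6]
  field_simp
  ring

variable (t : 𝕜) (ht : t ^ 2 = c * (p.q ^ 2 + 1) / p.q) (ε : ℤˣ)

variable {M} {lam m : ℂ} {y z : M.V}

theorem IsLinked.dirac_up (h : IsLinked p M lam m y z) (hc : c ≠ 0) :
    dirac p c M t ht ε (y ⊗ₜ spinUp) =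
      (((ε : ℤ) : 𝕜) * (t / c) * diagCoeff p lam m) • (y ⊗ₜ spinUp) +
        (t / c * lowerCoeff p lam m) • (z ⊗ₜ spinDown) := by
  have hFE : M.rep (Uq.gen p .F) (M.rep (Uq.gen p .E) y) =
      (p.qnum m * p.qnum (lam - m + 1)) • y := by
    rw [h.E_apply, map_smul, h.F_apply, smul_smul, mul_comm]
  have hEF : M.rep (Uq.gen p .E) (M.rep (Uq.gen p .F) y) =
      (p.qnum m * p.qnum (lam - m + 1) + (p.q - p.q⁻¹)⁻¹ *
        (p.pow (lam - 2 * m) - p.pow (-(lam - 2 * m)))) • y := by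
    rw [M.rep_E_F, hFE, h.K_left, h.Kinv_left]
    module
  rw [dirac_tmul, braiding_v_zero, braiding_v_one, braiding_v_two, braiding_cubic]
  simp only [map_add, map_sub, map_smul, spinAction_tmul, spin_v_zero_up, spin_v_one_up,
    spin_v_two_up, spin_cubic_up, TensorProduct.tmul_zero, TensorProduct.tmul_smul,
    smul_zero, sub_zero, add_zero, Uq.X, Uq.Z, Uq.C, map_mul, LinearMap.sub_apply,
    LinearMap.add_apply, LinearMap.smul_apply, Module.End.mul_apply, hEF, h.K_left,
    h.Kinv_left, h.E_apply, h.F_apply, ← TensorProduct.smul_tmul', TensorProduct.add_tmul,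
    TensorProduct.sub_tmul]
  have h1 := p.pow_ne_zero lam
  have h2 := p.pow_ne_zero m
  have h3 := p.q_ne_zero
  have h4 := p.q_sq_sub_one
  have h5 := p.two_ne_zero
  have h7 := p.q_sq_add_one
  have h8 : 1 + p.q ^ 2 ≠ 0 := by rwa [add_comm]
  have hqq : p.q - p.q⁻¹ = (p.q ^ 2 - 1) / p.q := by field_simp
  have h6 : p.pow 1 = p.q := rfl
  match_scalars <;>
    simp only [diagCoeff, lowerCoeff, QParam.qnum, p.pow_neg, p.pow_add, p.pow_sub,
      p.pow_two_mul, hqq, h6] <;>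
    (field_simp; try ring)

theorem IsLinked.dirac_down (h : IsLinked p M lam m y z) (hc : c ≠ 0) :
    dirac p c M t ht ε (z ⊗ₜ spinDown) =
      (t / c * p.qnum m) • (y ⊗ₜ spinUp) -
        (((ε : ℤ) : 𝕜) * (t / c) * diagCoeff p lam m) • (z ⊗ₜ spinDown) := by
  have hFE : M.rep (Uq.gen p .F) (M.rep (Uq.gen p .E) y) =
      (p.qnum m * p.qnum (lam - m + 1)) • y := by
    rw [h.E_apply, map_smul, h.F_apply, smul_smul, mul_comm]
  have hEF : M.rep (Uq.gen p .E) (M.rep (Uq.gen p .F) y) =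
      (p.qnum m * p.qnum (lam - m + 1) + (p.q - p.q⁻¹)⁻¹ *
        (p.pow (lam - 2 * m) - p.pow (-(lam - 2 * m)))) • y := by
    rw [M.rep_E_F, hFE, h.K_left, h.Kinv_left]
    module
  have hEFz : M.rep (Uq.gen p .E) (M.rep (Uq.gen p .F) z) =
      (p.qnum m * p.qnum (lam - m + 1)) • z := by
    rw [h.F_apply, map_smul, h.E_apply, smul_smul]
  have hFEz : M.rep (Uq.gen p .F) (M.rep (Uq.gen p .E) z) =
      (p.qnum m * p.qnum (lam - m + 1) - (p.q - p.q⁻¹)⁻¹ *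
        (p.pow (lam - 2 * m + 2) - p.pow (-(lam - 2 * m + 2)))) • z := by
    have := M.rep_E_F p z
    rw [hEFz, h.K_right, h.Kinv_right, ← sub_eq_iff_eq_add] at this
    rw [← this]
    module
  rw [dirac_tmul, braiding_v_zero, braiding_v_one, braiding_v_two, braiding_cubic]
  simp only [map_add, map_sub, map_smul, spinAction_tmul, spin_v_zero_down, spin_v_one_down,
    spin_v_two_down, spin_cubic_down, TensorProduct.tmul_zero, TensorProduct.tmul_smul,
    Uq.X, Uq.Y, Uq.Z, Uq.C, map_mul, LinearMap.sub_apply,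
    LinearMap.add_apply, LinearMap.smul_apply, Module.End.mul_apply, hFEz, h.K_right,
    h.Kinv_right, h.E_apply, h.F_apply, M.rep_E_K, hEF, h.K_left, ← TensorProduct.smul_tmul',
    TensorProduct.add_tmul, TensorProduct.sub_tmul]
  have h1 := p.pow_ne_zero lam
  have h2 := p.pow_ne_zero m
  have h3 := p.q_ne_zero
  have h4 := p.q_sq_sub_one
  have h5 := p.two_ne_zero
  have h7 := p.q_sq_add_one
  have h8 : 1 + p.q ^ 2 ≠ 0 := by rwa [add_comm]
  have hqq : p.q - p.q⁻¹ = (p.q ^ 2 - 1) / p.q := by field_simp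
  have h6 : p.pow 1 = p.q := rfl
  have h9 := p.pow_two
  match_scalars <;>
    simp only [diagCoeff, QParam.qnum, p.pow_neg, p.pow_add, p.pow_sub,
      p.pow_two_mul, hqq, h6, h9] <;>
    (field_simp; ring)

end Block

theorem QParam.pow_natCast (n : ℕ) : p.pow n = p.q ^ n := by
  induction n with
  | zero => simp [p.pow_zero]
  | succ n ih => rw [Nat.cast_succ, p.pow_add, ih, pow_succ, QParam.q]

theorem QParam.qnum_ne_zero_iff (z : ℂ) : p.qnum z ≠ 0 ↔ p.pow (2 * z) ≠ 1 := by
  have h := p.pow_ne_zero z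
  rw [QParam.qnum, Ne, div_eq_zero_iff, or_iff_left p.q_sub_inv, p.pow_neg, sub_eq_zero,
    ← mul_eq_one_iff_eq_inv₀ h, ← sq, ← p.pow_two_mul]

theorem QParam.qnum_natCast_ne_zero {n : ℕ} (hn : 0 < n) : p.qnum n ≠ 0 := by
  rw [p.qnum_ne_zero_iff]
  have := p.not_root (2 * n) (by omega)
  rwa [← QParam.q, ← p.pow_natCast, Nat.cast_mul, Nat.cast_two] at this

section Cohomology

variable {V : Type*} [AddCommGroup V] [Module 𝕜 V] (D : Module.End 𝕜 V) (x : V) (hx : D x = 0)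

theorem cohomologyClass_ne_zero (φ : V →ₗ[𝕜] 𝕜) (hφ : ∀ y, φ (D y) = 0) (h : φ x ≠ 0) :
    cohomologyClass D x hx ≠ 0 := by
  intro h0
  rw [cohomologyClass, Submodule.Quotient.mk_eq_zero] at h0
  obtain ⟨⟨y, hy⟩, -⟩ := h0
  exact h ((congrArg φ hy).symm.trans (hφ y))

theorem cohomologyClass_span_eq_top (h : ∀ y, D y = 0 → ∃ (r : 𝕜) (z : V), y = D z + r • x) :
    Submodule.span 𝕜 {cohomologyClass D x hx} = ⊤ := by
  rw [eq_top_iff]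
  rintro y -
  obtain ⟨y, rfl⟩ := Submodule.Quotient.mk_surjective _ y
  obtain ⟨r, z, hz⟩ := h y y.2
  rw [Submodule.mem_span_singleton]
  refine ⟨r, ?_⟩
  rw [cohomologyClass, ← Submodule.Quotient.mk_smul, eq_comm, Submodule.Quotient.eq]
  exact ⟨⟨z, eq_sub_of_add_eq hz.symm⟩, Subtype.prop (y - r • ⟨x, hx⟩)⟩

end Cohomology

section Linked

variable {M : WtModule p}

theorem spinTensor_ext {N : Type*} [AddCommGroup N] [Module 𝕜 N] {f g : SpinTensor p M →ₗ[𝕜] N}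
    (up : ∀ i, f (M.w i ⊗ₜ spinUp) = g (M.w i ⊗ₜ spinUp))
    (down : ∀ i, f (M.w i ⊗ₜ spinDown) = g (M.w i ⊗ₜ spinDown)) : f = g := by
  refine (M.w.tensorProduct (Pi.basisFun 𝕜 (Fin 2))).ext fun ⟨i, j⟩ => ?_
  fin_cases j
  · simpa using up i
  · simpa using down i

variable (t : 𝕜) (ht : t ^ 2 = c * (p.q ^ 2 + 1) / p.q) (ε : ℤˣ) {lam m : ℂ} {y z : M.V}

theorem sign_sq : ((ε : ℤ) : 𝕜) ^ 2 = 1 := by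
  rcases Int.units_eq_one_or ε with rfl | rfl <;> simp

theorem IsLinked.dirac_dirac_up (h : IsLinked p M lam m y z) (hc : c ≠ 0) :
    dirac p c M t ht ε (dirac p c M t ht ε (y ⊗ₜ spinUp)) =
      (t / (2 * c) * p.qnum (lam + 1)) ^ 2 • (y ⊗ₜ spinUp) := by
  have h2 := p.two_ne_zero
  rw [h.dirac_up p c t ht ε hc, map_add, map_smul, map_smul, h.dirac_up p c t ht ε hc,
    h.dirac_down p c t ht ε hc]
  linear_combination (norm := (match_scalars <;> field_simp <;> ring))
    (t ^ 2 / c ^ 2 * diagCoeff p lam m ^ 2 * sign_sq (𝕜 := 𝕜) ε +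
      t ^ 2 / c ^ 2 * diagCoeff_sq p lam m) • (y ⊗ₜ[𝕜] spinUp : SpinTensor p M)

theorem IsLinked.dirac_dirac_down (h : IsLinked p M lam m y z) (hc : c ≠ 0) :
    dirac p c M t ht ε (dirac p c M t ht ε (z ⊗ₜ spinDown)) =
      (t / (2 * c) * p.qnum (lam + 1)) ^ 2 • (z ⊗ₜ spinDown) := by
  have h2 := p.two_ne_zero
  rw [h.dirac_down p c t ht ε hc, map_sub, map_smul, map_smul, h.dirac_up p c t ht ε hc,
    h.dirac_down p c t ht ε hc]
  linear_combination (norm := (match_scalars <;> field_simp <;> ring))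
    (t ^ 2 / c ^ 2 * diagCoeff p lam m ^ 2 * sign_sq (𝕜 := 𝕜) ε +
      t ^ 2 / c ^ 2 * diagCoeff_sq p lam m) • (z ⊗ₜ[𝕜] spinDown : SpinTensor p M)

/-- A weight module with highest weight `λ` whose basis vectors form a single string. -/
def IsString (M : WtModule p) (lam : ℂ) : Prop :=
  ∀ i : M.ι, (∃ (m : ℂ) (z : M.V), IsLinked p M lam m (M.w i) z) ∧
    ∃ (m : ℂ) (y : M.V), IsLinked p M lam m y (M.w i)

theorem IsString.dirac_sq (h : IsString p M lam) (hc : c ≠ 0) :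
    dirac p c M t ht ε ∘ₗ dirac p c M t ht ε =
      (t / (2 * c) * p.qnum (lam + 1)) ^ 2 • LinearMap.id := by
  refine spinTensor_ext p (fun i => ?_) fun i => ?_
  · obtain ⟨m, z, hl⟩ := (h i).1
    exact hl.dirac_dirac_up p c t ht ε hc
  · obtain ⟨m, y, hl⟩ := (h i).2
    exact hl.dirac_dirac_down p c t ht ε hc

include ht in
theorem t_ne_zero (hc : c ≠ 0) : t ≠ 0 := by
  rintro rfl
  have h1 := p.q_ne_zero
  have h2 := p.q_sq_add_one
  have : c * (p.q ^ 2 + 1) / p.q ≠ 0 := div_ne_zero (mul_ne_zero hc h2) h1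
  exact this (by rw [← ht]; ring)

theorem IsString.subsingleton_diracCohomology (h : IsString p M lam) (hc : c ≠ 0)
    (hlam : p.qnum (lam + 1) ≠ 0) : Subsingleton (DiracCohomology p c M t ht ε) := by
  have hμ : (t / (2 * c) * p.qnum (lam + 1)) ^ 2 ≠ 0 :=
    pow_ne_zero 2 (mul_ne_zero (div_ne_zero (t_ne_zero p c t ht hc)
      (mul_ne_zero p.two_ne_zero hc)) hlam)
  have hker : LinearMap.ker (dirac p c M t ht ε) = ⊥ := by
    rw [LinearMap.ker_eq_bot']
    intro x hx
    have := LinearMap.congr_fun (h.dirac_sq p c t ht ε hc) x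
    rw [LinearMap.comp_apply, hx, map_zero] at this
    exact (smul_eq_zero.1 this.symm).resolve_left hμ
  have : Subsingleton (LinearMap.ker (dirac p c M t ht ε)) := by
    rw [hker]
    infer_instance
  exact (Submodule.mkQ_surjective _).subsingleton

end Linked

section FiniteDimensional

/-- The vector `w_m` of `V_{kπ}`, equal to zero for `m > k`. -/
noncomputable def finVec (𝕜 : Type u) [Field 𝕜] (k m : ℕ) : Fin (k + 1) →₀ 𝕜 :=
  if h : m < k + 1 then Finsupp.single ⟨m, h⟩ 1 else 0

theorem finVec_of_le {k m : ℕ} (h : m ≤ k) :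
    finVec 𝕜 k m = Finsupp.single ⟨m, Nat.lt_succ_of_le h⟩ 1 :=
  dif_pos _

theorem finVec_of_lt {k m : ℕ} (h : k < m) : finVec 𝕜 k m = 0 :=
  dif_neg (by omega)

theorem finE_finVec_zero (k : ℕ) : finE p k (finVec 𝕜 k 0) = 0 := by
  rw [finVec_of_le k.zero_le]
  exact finE_zero p k _

theorem finE_finVec_succ {k m : ℕ} (hm : m ≤ k) :
    finE p k (finVec 𝕜 k (m + 1)) = p.qnum (k - (m + 1) + 1) • finVec 𝕜 k m := by
  rcases hm.lt_or_eq with h | rfl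
  · rw [finVec_of_le h, finVec_of_le hm]
    exact finE_succ p k m _
  · rw [finVec_of_lt m.lt_succ_self, map_zero, sub_add_cancel_left, neg_add_cancel, p.qnum_zero,
      zero_smul]

theorem finF_finVec {k m : ℕ} (hm : m ≤ k) :
    finF p k (finVec 𝕜 k m) = p.qnum (m + 1) • finVec 𝕜 k (m + 1) := by
  rcases hm.lt_or_eq with h | rfl
  · rw [finVec_of_le h, finVec_of_le hm]
    exact finF_lt p k m _ _
  · rw [finVec_of_lt m.lt_succ_self, finVec_of_le le_rfl, smul_zero]
    exact finF_last p m m _ (lt_irrefl _)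

theorem finK_finVec (k m : ℕ) {a : ℂ} (ha : a = k - 2 * m) :
    finK p k (finVec 𝕜 k m) = p.pow a • finVec 𝕜 k m := by
  subst ha
  rcases le_or_gt m k with h | h
  · rw [finVec_of_le h]
    exact finK_single p k m _
  · rw [finVec_of_lt h, map_zero, smul_zero]

theorem finKinv_finVec (k m : ℕ) {a : ℂ} (ha : a = k - 2 * m) :
    finKinv p k (finVec 𝕜 k m) = p.pow (-a) • finVec 𝕜 k m := by
  subst ha
  rcases le_or_gt m k with h | h
  · rw [finVec_of_le h]
    exact finKinv_single p k m _
  · rw [finVec_of_lt h, map_zero, smul_zero]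

theorem finMod_w {k m : ℕ} (h : m ≤ k) :
    (finMod p k).w (⟨m, Nat.lt_succ_of_le h⟩ : Fin (k + 1)) = finVec 𝕜 k m :=
  (congrFun Finsupp.coe_basisSingleOne _).trans (finVec_of_le h).symm

theorem isLinked_finVec_zero (k : ℕ) : IsLinked p (finMod p k) k 0 (finVec 𝕜 k 0) 0 where
  E_apply := ((LinearMap.congr_fun (finRep_gen p k .E) _).trans (finE_finVec_zero p k)).trans
    (smul_zero _).symm
  F_apply := (map_zero _).trans (by rw [p.qnum_zero]; exact (zero_smul 𝕜 _).symm)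
  K_left := (LinearMap.congr_fun (finRep_gen p k .K) _).trans (finK_finVec p k 0 (by simp))
  K_right := by rw [map_zero, smul_zero]
  Kinv_left := (LinearMap.congr_fun (finRep_gen p k .Kinv) _).trans
    (finKinv_finVec p k 0 (by simp))
  Kinv_right := by rw [map_zero, smul_zero]

theorem isLinked_finVec_succ {k m : ℕ} (hm : m ≤ k) :
    IsLinked p (finMod p k) k (m + 1) (finVec 𝕜 k (m + 1)) (finVec 𝕜 k m) where
  E_apply := (LinearMap.congr_fun (finRep_gen p k .E) _).trans (finE_finVec_succ p hm)
  F_apply := (LinearMap.congr_fun (finRep_gen p k .F) _).trans (finF_finVec p hm)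
  K_left := (LinearMap.congr_fun (finRep_gen p k .K) _).trans
    (finK_finVec p k (m + 1) (by push_cast; ring))
  K_right := (LinearMap.congr_fun (finRep_gen p k .K) _).trans (finK_finVec p k m (by ring))
  Kinv_left := (LinearMap.congr_fun (finRep_gen p k .Kinv) _).trans
    (finKinv_finVec p k (m + 1) (by push_cast; ring))
  Kinv_right := (LinearMap.congr_fun (finRep_gen p k .Kinv) _).trans
    (finKinv_finVec p k m (by ring))

theorem isString_finMod (k : ℕ) : IsString p (finMod p k) k := by
  rintro ⟨m, hm⟩
  have hm' := Nat.lt_succ_iff.1 hm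
  have hw := finMod_w p hm'
  refine ⟨?_, _, _, hw ▸ isLinked_finVec_succ p hm'⟩
  rcases m with _ | m
  · exact ⟨_, _, hw ▸ isLinked_finVec_zero p k⟩
  · exact ⟨_, _, hw ▸ isLinked_finVec_succ p (by omega)⟩

theorem subsingleton_diracCohomology_finMod (t : 𝕜) (ht : t ^ 2 = c * (p.q ^ 2 + 1) / p.q)
    (ε : ℤˣ) (hc : c ≠ 0) (k : ℕ) : Subsingleton (DiracCohomology p c (finMod p k) t ht ε) :=
  (isString_finMod p k).subsingleton_diracCohomology p c t ht ε hc
    (by exact_mod_cast p.qnum_natCast_ne_zero k.succ_pos)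

end FiniteDimensional

section Verma

variable (lam : ℂ)

/-- The vector `w_m` of the Verma module. -/
noncomputable abbrev vermaVec (m : ℕ) : (verma p lam).V := (verma p lam).w (m : ℕ)

theorem vermaVec_eq (m : ℕ) : vermaVec p lam m = (Finsupp.single m 1 : ℕ →₀ 𝕜) :=
  congrFun Finsupp.coe_basisSingleOne m

theorem isLinked_vermaVec_zero : IsLinked p (verma p lam) lam 0 (vermaVec p lam 0) 0 := by
  rw [vermaVec_eq]
  have h : lam - 2 * 0 = lam - 2 * (0 : ℕ) := by simp
  exact
  { E_apply := ((LinearMap.congr_fun (vermaRep_gen p lam .E) _).trans (vermaE_zero p lam)).trans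
      (smul_zero _).symm
    F_apply := (map_zero _).trans (by rw [p.qnum_zero]; exact (zero_smul 𝕜 _).symm)
    K_left := h ▸ (LinearMap.congr_fun (vermaRep_gen p lam .K) _).trans (vermaK_single p lam 0)
    K_right := by rw [map_zero, smul_zero]
    Kinv_left := h ▸ (LinearMap.congr_fun (vermaRep_gen p lam .Kinv) _).trans
      (vermaKinv_single p lam 0)
    Kinv_right := by rw [map_zero, smul_zero] }

theorem isLinked_vermaVec_succ (m : ℕ) :
    IsLinked p (verma p lam) lam (m + 1) (vermaVec p lam (m + 1)) (vermaVec p lam m) := by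
  rw [vermaVec_eq, vermaVec_eq]
  have h : lam - 2 * (m + 1) = lam - 2 * (m + 1 : ℕ) := by push_cast; rfl
  have h' : lam - 2 * (m + 1) + 2 = lam - 2 * m := by ring
  exact
  { E_apply := (LinearMap.congr_fun (vermaRep_gen p lam .E) _).trans (vermaE_succ p lam m)
    F_apply := (LinearMap.congr_fun (vermaRep_gen p lam .F) _).trans (vermaF_single p m)
    K_left := h ▸ (LinearMap.congr_fun (vermaRep_gen p lam .K) _).trans
      (vermaK_single p lam (m + 1))
    K_right := h' ▸ (LinearMap.congr_fun (vermaRep_gen p lam .K) _).trans (vermaK_single p lam m)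
    Kinv_left := h ▸ (LinearMap.congr_fun (vermaRep_gen p lam .Kinv) _).trans
      (vermaKinv_single p lam (m + 1))
    Kinv_right := h' ▸ (LinearMap.congr_fun (vermaRep_gen p lam .Kinv) _).trans
      (vermaKinv_single p lam m) }

theorem isString_verma : IsString p (verma p lam) lam := by
  intro m
  change ℕ at m
  refine ⟨?_, _, _, isLinked_vermaVec_succ p lam m⟩
  rcases m with _ | m
  · exact ⟨_, _, isLinked_vermaVec_zero p lam⟩
  · exact ⟨_, _, isLinked_vermaVec_succ p lam m⟩

variable (t : 𝕜) (ht : t ^ 2 = c * (p.q ^ 2 + 1) / p.q) (ε : ℤˣ)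

theorem dirac_vermaUp_zero (hc : c ≠ 0) :
    dirac p c (verma p lam) t ht ε (vermaUp p lam 0) =
      (-((ε : ℤ) : 𝕜) * (t / (2 * c) * p.qnum (lam + 1))) • vermaUp p lam 0 := by
  have h2 := p.two_ne_zero
  rw [vermaUp, (isLinked_vermaVec_zero p lam).dirac_up p c t ht ε hc, diagCoeff_zero,
    TensorProduct.zero_tmul, smul_zero, add_zero]
  congr 1
  field_simp

theorem dirac_vermaUp_succ (hc : c ≠ 0) (m : ℕ) :
    dirac p c (verma p lam) t ht ε (vermaUp p lam (m + 1)) =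
      (((ε : ℤ) : 𝕜) * (t / c) * diagCoeff p lam (m + 1)) • vermaUp p lam (m + 1) +
        (t / c * lowerCoeff p lam (m + 1)) • vermaDown p lam m :=
  (isLinked_vermaVec_succ p lam m).dirac_up p c t ht ε hc

theorem dirac_vermaDown (hc : c ≠ 0) (m : ℕ) :
    dirac p c (verma p lam) t ht ε (vermaDown p lam m) =
      (t / c * p.qnum (m + 1)) • vermaUp p lam (m + 1) -
        (((ε : ℤ) : 𝕜) * (t / c) * diagCoeff p lam (m + 1)) • vermaDown p lam m :=
  (isLinked_vermaVec_succ p lam m).dirac_down p c t ht ε hc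

theorem dirac_mem_vermaBlock (hc : c ≠ 0) {m : ℕ} (hm : 1 ≤ m) {x : SpinTensor p (verma p lam)}
    (hx : x ∈ vermaBlock p lam m) : dirac p c (verma p lam) t ht ε x ∈ vermaBlock p lam m := by
  obtain ⟨m, rfl⟩ := Nat.exists_eq_add_of_le' hm
  have hu : vermaUp p lam (m + 1) ∈ vermaBlock p lam (m + 1) :=
    Submodule.subset_span (Set.mem_insert _ _)
  have hd : vermaDown p lam m ∈ vermaBlock p lam (m + 1) :=
    Submodule.subset_span (Set.mem_insert_of_mem _ rfl)
  suffices vermaBlock p lam (m + 1) ≤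
      (vermaBlock p lam (m + 1)).comap (dirac p c (verma p lam) t ht ε) from this hx
  conv_lhs => rw [vermaBlock]
  rw [Submodule.span_le]
  rintro _ (rfl | rfl)
  · rw [SetLike.mem_coe, Submodule.mem_comap, dirac_vermaUp_succ p c lam t ht ε hc]
    exact add_mem (Submodule.smul_mem _ _ hu) (Submodule.smul_mem _ _ hd)
  · rw [SetLike.mem_coe, Submodule.mem_comap, Nat.add_sub_cancel,
      dirac_vermaDown p c lam t ht ε hc]
    exact sub_mem (Submodule.smul_mem _ _ hu) (Submodule.smul_mem _ _ hd)

/-- The coefficient of `w_m ⊗ s₁` of a vector in `M_{λπ} ⊗ S_±`. -/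
noncomputable def upCoord (m : ℕ) : SpinTensor p (verma p lam) →ₗ[𝕜] 𝕜 :=
  LinearMap.mul' 𝕜 𝕜 ∘ₗ TensorProduct.map ((verma p lam).w.coord (m : ℕ)) (LinearMap.proj 0)

theorem upCoord_vermaUp (m n : ℕ) :
    upCoord p lam m (vermaUp p lam n) = if n = m then 1 else 0 := by
  have : (verma p lam).w.repr ((verma p lam).w (n : ℕ)) (m : ℕ) = if n = m then 1 else 0 := by
    exact (DFunLike.congr_fun (Module.Basis.repr_self _ _) _).trans
      (Finsupp.single_apply (α := ℕ) (a := n) (a' := m) (b := (1 : 𝕜)))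
  refine Eq.trans ?_ this
  simp only [upCoord, vermaUp, LinearMap.comp_apply, TensorProduct.map_tmul,
    LinearMap.mul'_apply, LinearMap.proj_apply, Pi.single_eq_same, mul_one]
  rfl

theorem upCoord_vermaDown (m n : ℕ) : upCoord p lam m (vermaDown p lam n) = 0 := by
  simp [upCoord, vermaDown]

theorem exists_eigenvector_vermaBlock_iff (hc : c ≠ 0) {m : ℕ} (hm : 1 ≤ m) (ν : 𝕜) :
    (∃ x ∈ vermaBlock p lam m, x ≠ 0 ∧ dirac p c (verma p lam) t ht ε x = ν • x) ↔
      ν = t / (2 * c) * p.qnum (lam + 1) ∨ ν = -(t / (2 * c) * p.qnum (lam + 1)) := by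
  have hsq := LinearMap.congr_fun ((isString_verma p lam).dirac_sq p c t ht ε hc)
  simp only [LinearMap.comp_apply, LinearMap.smul_apply, LinearMap.id_apply] at hsq
  rw [← sq_eq_sq_iff_eq_or_eq_neg]
  generalize (t / (2 * c) * p.qnum (lam + 1)) ^ 2 = μ at hsq ⊢
  constructor
  · rintro ⟨x, -, hx, h⟩
    have h1 := hsq x
    rw [h, map_smul, h, smul_smul, ← sq] at h1
    exact smul_left_injective 𝕜 hx h1
  · rintro rfl
    obtain ⟨m, rfl⟩ := Nat.exists_eq_add_of_le' hm
    have hd : vermaDown p lam m ∈ vermaBlock p lam (m + 1) :=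
      Submodule.subset_span (Set.mem_insert_of_mem _ rfl)
    refine ⟨dirac p c (verma p lam) t ht ε (vermaDown p lam m) + ν • vermaDown p lam m,
      add_mem (dirac_mem_vermaBlock p c lam t ht ε hc hm hd) (Submodule.smul_mem _ _ hd),
      fun h0 => ?_, ?_⟩
    · have h1 := congrArg (upCoord p lam (m + 1)) h0
      rw [dirac_vermaDown p c lam t ht ε hc] at h1
      simp only [map_add, map_sub, map_smul, upCoord_vermaUp, upCoord_vermaDown, if_true,
        smul_eq_mul, mul_one, mul_zero, sub_zero, add_zero, map_zero] at h1
      have h2 := p.qnum_natCast_ne_zero m.succ_pos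
      rw [Nat.cast_succ] at h2
      exact mul_ne_zero (div_ne_zero (t_ne_zero p c t ht hc) hc) h2 h1
    · rw [map_add, map_smul, hsq]
      module

/-- The map `w_{m+1} ↦ c / (t [m + 1]) w_m` of the Verma module. -/
noncomputable def vermaShift : Module.End 𝕜 (verma p lam).V :=
  (verma p lam).w.constr 𝕜 fun m : ℕ =>
    if m = 0 then 0 else (t / c * p.qnum m)⁻¹ • vermaVec p lam (m - 1)

theorem vermaShift_zero : vermaShift p c lam t (vermaVec p lam 0) = 0 :=
  (Module.Basis.constr_basis _ _ _ _).trans (if_pos rfl)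

theorem vermaShift_succ (m : ℕ) : vermaShift p c lam t (vermaVec p lam (m + 1)) =
    (t / c * p.qnum (m + 1))⁻¹ • vermaVec p lam m := by
  refine (Module.Basis.constr_basis _ _ _ _).trans ((if_neg m.succ_ne_zero).trans ?_)
  rw [Nat.cast_succ, Nat.add_sub_cancel]

/-- A contracting homotopy, up to the span of `w_0 ⊗ s₁`, for the Dirac operator on `M_{-π} ⊗ S_±`:
the map `w_{m+1} ⊗ s₁ ↦ c / (t [m + 1]) w_m ⊗ s₋₁`. -/
noncomputable def vermaHomotopy : Module.End 𝕜 (SpinTensor p (verma p lam)) :=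
  TensorProduct.map (vermaShift p c lam t) (Matrix.toLin' !![0, 0; 1, 0])

theorem vermaHomotopy_vermaUp_zero : vermaHomotopy p c lam t (vermaUp p lam 0) = 0 := by
  rw [vermaHomotopy, vermaUp, TensorProduct.map_tmul, vermaShift_zero, TensorProduct.zero_tmul]

theorem vermaHomotopy_vermaUp_succ (m : ℕ) : vermaHomotopy p c lam t (vermaUp p lam (m + 1)) =
    (t / c * p.qnum (m + 1))⁻¹ • vermaDown p lam m := by
  have h : Matrix.toLin' !![0, 0; 1, 0] (Pi.single 0 1 : Fin 2 → 𝕜) = Pi.single 1 1 := by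
    ext j
    fin_cases j <;> simp
  rw [vermaHomotopy, vermaUp, TensorProduct.map_tmul, vermaShift_succ, h,
    ← TensorProduct.smul_tmul', vermaDown]

theorem vermaHomotopy_vermaDown (m : ℕ) : vermaHomotopy p c lam t (vermaDown p lam m) = 0 := by
  have h : Matrix.toLin' !![0, 0; 1, 0] (Pi.single 1 1 : Fin 2 → 𝕜) = 0 := by
    ext j
    fin_cases j <;> simp
  rw [vermaHomotopy, vermaDown, TensorProduct.map_tmul, h, TensorProduct.tmul_zero]

theorem dirac_vermaUp_neg_one (hc : c ≠ 0) :
    dirac p c (verma p (-1)) t ht ε (vermaUp p (-1) 0) = 0 := by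
  rw [dirac_vermaUp_zero p c (-1) t ht ε hc, neg_add_cancel, p.qnum_zero, mul_zero, mul_zero,
    zero_smul]

theorem dirac_homotopy (hc : c ≠ 0) (x : SpinTensor p (verma p (-1))) :
    dirac p c (verma p (-1)) t ht ε (vermaHomotopy p c (-1) t x) +
      vermaHomotopy p c (-1) t (dirac p c (verma p (-1)) t ht ε x) +
      upCoord p (-1) 0 x • vermaUp p (-1) 0 = x := by
  have hγ (m : ℕ) : t / c * p.qnum (m + 1) ≠ 0 := by
    have h2 := p.qnum_natCast_ne_zero m.succ_pos
    rw [Nat.cast_succ] at h2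
    exact mul_ne_zero (div_ne_zero (t_ne_zero p c t ht hc) hc) h2
  suffices dirac p c (verma p (-1)) t ht ε ∘ₗ vermaHomotopy p c (-1) t +
      vermaHomotopy p c (-1) t ∘ₗ dirac p c (verma p (-1)) t ht ε +
      (upCoord p (-1) 0).smulRight (vermaUp p (-1) 0) = LinearMap.id from
    LinearMap.congr_fun this x
  refine spinTensor_ext p (fun m => ?_) fun m => ?_
  · change ℕ at m
    change dirac p c (verma p (-1)) t ht ε (vermaHomotopy p c (-1) t (vermaUp p (-1) m)) +
      vermaHomotopy p c (-1) t (dirac p c (verma p (-1)) t ht ε (vermaUp p (-1) m)) +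
      upCoord p (-1) 0 (vermaUp p (-1) m) • vermaUp p (-1) 0 = vermaUp p (-1) m
    rcases m with _ | m
    · rw [vermaHomotopy_vermaUp_zero, dirac_vermaUp_neg_one p c t ht ε hc, upCoord_vermaUp]
      simp
    · rw [vermaHomotopy_vermaUp_succ, dirac_vermaUp_succ p c _ t ht ε hc, upCoord_vermaUp,
        if_neg m.succ_ne_zero, map_add, map_smul, map_smul, map_smul, vermaHomotopy_vermaUp_succ,
        vermaHomotopy_vermaDown, dirac_vermaDown p c _ t ht ε hc, smul_sub, smul_smul,
        inv_mul_cancel₀ (hγ m)]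
      module
  · change ℕ at m
    change dirac p c (verma p (-1)) t ht ε (vermaHomotopy p c (-1) t (vermaDown p (-1) m)) +
      vermaHomotopy p c (-1) t (dirac p c (verma p (-1)) t ht ε (vermaDown p (-1) m)) +
      upCoord p (-1) 0 (vermaDown p (-1) m) • vermaUp p (-1) 0 = vermaDown p (-1) m
    rw [vermaHomotopy_vermaDown, dirac_vermaDown p c _ t ht ε hc, upCoord_vermaDown, map_sub,
      map_smul, map_smul, vermaHomotopy_vermaUp_succ, vermaHomotopy_vermaDown, smul_smul,
      mul_inv_cancel₀ (hγ m)]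
    simp

theorem upCoord_zero_dirac (hc : c ≠ 0) (x : SpinTensor p (verma p (-1))) :
    upCoord p (-1) 0 (dirac p c (verma p (-1)) t ht ε x) = 0 := by
  suffices upCoord p (-1) 0 ∘ₗ dirac p c (verma p (-1)) t ht ε = 0 from
    LinearMap.congr_fun this x
  refine spinTensor_ext p (fun m => ?_) fun m => ?_
  · change ℕ at m
    change upCoord p (-1) 0 (dirac p c (verma p (-1)) t ht ε (vermaUp p (-1) m)) = 0
    rcases m with _ | m
    · rw [dirac_vermaUp_neg_one p c t ht ε hc, map_zero]
    · rw [dirac_vermaUp_succ p c _ t ht ε hc]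
      simp [upCoord_vermaUp, upCoord_vermaDown]
  · change ℕ at m
    change upCoord p (-1) 0 (dirac p c (verma p (-1)) t ht ε (vermaDown p (-1) m)) = 0
    rw [dirac_vermaDown p c _ t ht ε hc]
    simp [upCoord_vermaUp, upCoord_vermaDown]

theorem diracCohomology_verma_neg_one (hc : c ≠ 0) :
    ∃ h : dirac p c (verma p (-1)) t ht ε (vermaUp p (-1) 0) = 0,
      cohomologyClass _ _ h ≠ 0 ∧ Submodule.span 𝕜 {cohomologyClass _ _ h} = ⊤ := by
  refine ⟨dirac_vermaUp_neg_one p c t ht ε hc, cohomologyClass_ne_zero _ _ _ (upCoord p (-1) 0)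
    (upCoord_zero_dirac p c t ht ε hc) ?_, cohomologyClass_span_eq_top _ _ _ fun x hx =>
      ⟨upCoord p (-1) 0 x, vermaHomotopy p c (-1) t x, ?_⟩⟩
  · rw [upCoord_vermaUp, if_pos rfl]
    exact one_ne_zero
  · have h := dirac_homotopy p c t ht ε hc x
    rw [hx, map_zero, add_zero] at h
    exact h.symm

end Verma

theorem formalParam_qnum_ne_zero (𝕜 : Type*) [Field 𝕜] [Algebra ℂ⸨X⸩ 𝕜] {z : ℂ} (hz : z ≠ 0) :
    (formalParam 𝕜).qnum z ≠ 0 := by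
  rw [QParam.qnum_ne_zero_iff]
  intro h
  have h1 := (algebraMap ℂ⸨X⸩ 𝕜).injective (h.trans (map_one _).symm)
  have h2 := HahnSeries.ofPowerSeries_injective (h1.trans (map_one _).symm)
  have h3 := congrArg (PowerSeries.coeff 1) h2
  simp [PowerSeries.coeff_rescale, PowerSeries.coeff_one, PowerSeries.coeff_exp, hz] at h3

end QDirac

open QDirac

theorem mainTheorem5 :
    -- the numerical parameter: `q = e ^ ħ` is a complex number, not a root of unity
    (∀ (ħ : ℂ) (hħ : ∀ n : ℕ, 0 < n → Complex.exp ħ ^ n ≠ 1)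
      (p : QParam ℂ) (_hp : p = complexParam ħ hħ)
      (c t : ℂ) (_hc : c ≠ 0) (ht : t ^ 2 = c * (p.q ^ 2 + 1) / p.q) (ε : ℤˣ),
      (∀ lam : ℂ, p.qnum (lam + 1) ≠ 0 → Subsingleton (DiracCohomology p c (verma p lam) t ht ε)) ∧
      (∀ k : ℕ, Subsingleton (DiracCohomology p c (finMod p k) t ht ε)) ∧
      (∃ h : dirac p c (verma p (-1)) t ht ε (vermaUp p (-1) 0) = 0,
        cohomologyClass _ _ h ≠ 0 ∧ Submodule.span ℂ {cohomologyClass _ _ h} = ⊤) ∧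
      (∀ lam : ℂ,
        dirac p c (verma p lam) t ht ε (vermaUp p lam 0) =
          (-((ε : ℤ) : ℂ) * (t / (2 * c) * p.qnum (lam + 1))) • vermaUp p lam 0 ∧
        ∀ m : ℕ, 1 ≤ m →
          (∀ x ∈ vermaBlock p lam m, dirac p c (verma p lam) t ht ε x ∈ vermaBlock p lam m) ∧
          ∀ ν : ℂ,
            (∃ x ∈ vermaBlock p lam m, x ≠ 0 ∧ dirac p c (verma p lam) t ht ε x = ν • x) ↔
              ν = t / (2 * c) * p.qnum (lam + 1) ∨ ν = -(t / (2 * c) * p.qnum (lam + 1)))) ∧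
    -- the formal parameter: `q = e ^ ħ` in a field extension of `ℂ((ħ))`
    (∀ (𝕜 : Type*) [Field 𝕜] [Algebra ℂ⸨X⸩ 𝕜]
      (p : QParam 𝕜) (_hp : p = formalParam 𝕜)
      (c t : 𝕜) (_hc : c ≠ 0) (ht : t ^ 2 = c * (p.q ^ 2 + 1) / p.q) (ε : ℤˣ),
      (∀ lam : ℂ, lam ≠ -1 → Subsingleton (DiracCohomology p c (verma p lam) t ht ε)) ∧
      (∀ k : ℕ, Subsingleton (DiracCohomology p c (finMod p k) t ht ε)) ∧
      (∃ h : dirac p c (verma p (-1)) t ht ε (vermaUp p (-1) 0) = 0,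
        cohomologyClass _ _ h ≠ 0 ∧ Submodule.span 𝕜 {cohomologyClass _ _ h} = ⊤) ∧
      (∀ lam : ℂ,
        dirac p c (verma p lam) t ht ε (vermaUp p lam 0) =
          (-((ε : ℤ) : 𝕜) * (t / (2 * c) * p.qnum (lam + 1))) • vermaUp p lam 0 ∧
        ∀ m : ℕ, 1 ≤ m →
          (∀ x ∈ vermaBlock p lam m, dirac p c (verma p lam) t ht ε x ∈ vermaBlock p lam m) ∧
          ∀ ν : 𝕜,
            (∃ x ∈ vermaBlock p lam m, x ≠ 0 ∧ dirac p c (verma p lam) t ht ε x = ν • x) ↔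
              ν = t / (2 * c) * p.qnum (lam + 1) ∨ ν = -(t / (2 * c) * p.qnum (lam + 1)))) := by
  refine ⟨fun ħ hħ p _ c t hc ht ε => ⟨fun lam hlam => ?_, ?_, ?_, fun lam => ⟨?_, fun m hm =>
    ⟨fun x hx => ?_, ?_⟩⟩⟩, fun 𝕜 _ _ p hp c t hc ht ε => ⟨fun lam hlam => ?_, ?_, ?_,
    fun lam => ⟨?_, fun m hm => ⟨fun x hx => ?_, ?_⟩⟩⟩⟩
  · exact (isString_verma p lam).subsingleton_diracCohomology p c t ht ε hc hlam
  · exact subsingleton_diracCohomology_finMod p c t ht ε hc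
  · exact diracCohomology_verma_neg_one p c t ht ε hc
  · exact dirac_vermaUp_zero p c lam t ht ε hc
  · exact dirac_mem_vermaBlock p c lam t ht ε hc hm hx
  · exact exists_eigenvector_vermaBlock_iff p c lam t ht ε hc hm
  · refine (isString_verma p lam).subsingleton_diracCohomology p c t ht ε hc ?_
    rw [hp]
    exact formalParam_qnum_ne_zero 𝕜 fun h => hlam (eq_neg_of_add_eq_zero_left h)
  · exact subsingleton_diracCohomology_finMod p c t ht ε hc
  · exact diracCohomology_verma_neg_one p c t ht ε hc
  · exact dirac_vermaUp_zero p c lam t ht ε hc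
  · exact dirac_mem_vermaBlock p c lam t ht ε hc hm hx
  · exact exists_eigenvector_vermaBlock_iff p c lam t ht ε hc hm
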